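/- Let $r,n\in\mathbb N$ and let $P_r(n)$ be the partition algebra over $\mathbb Q$: it has a basis given by the set-partitions (diagrams) of $\{1,\dots,r,\overline1,\dots,\overline r\}$, with $\overline1,\dots,\overline r$ the northern and $1,\dots,r$ the southern vertices; the product $xy$ is $n^m$ times the diagram obtained by placing $x$ above $y$, identifying the southern vertices of $x$ with the northern vertices of $y$, and removing the middle components, where $m$ is the number of connected components consisting only of middle vertices. Let $s_k=s_{k,k+1}$ $(1\le k<r)$ be the diagram with blocks $\{k,\overline{k+1}\}$, $\{k+1,\overline k\}$ and $\{j,\overline j\}$ for $j\ne k,k+1$; let $p_k$ $(1\le k\le r)$ have blocks $\{k\},\{\overline k\}$ and $\{j,\overline j\}$ for $j\neq k$; let $p_{k+\frac12}$ $(1\le k<r)$ have blocks $\{k,k+1,\overline k,\overline{k+1}\}$ and $\{j,\overline j\}$ for $j\ne k,k+1$. For $0\le l\le k$ put $e_k^{(l)}=p_{k-l+1}\cdots p_{k-1}p_k$ and $e_{k+\frac12}^{(l)}=p_{k-l+\frac32}\cdots p_{k-\frac12}p_{k+\frac12}$ ($l$ factors each, so both are $1$ if $l=0$). Put $s_{l,k}=s_ls_{l+1}\cdots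 s_{k-1}$ for $1\le l\le k\le r$ (as an element of $P_r(n)$; this agrees with the generator $s_{k,k+1}$), $s_{l,k}=s_{k,l}^{-1}$ for $1\le k<l\le r$, and $s_{l,k}=1$ if $l=0$ or $k=0$. For a partition $\lambda$ let $\ell(\lambda)$ be its number of non-zero parts, $[\lambda]_a=\lambda_1+\dots+\lambda_a$ and $[\lambda]_0=0$. For $i\geq 1$ let $\lambda\pm\varepsilon_i$ be obtained by adding/removing a box in row $i$, and let $\lambda\pm\varepsilon_0=\lambda$. For a partition $\nu$, let $\mathrm{Std}_r(\nu)$ be the set of sequences of partitions $$\varnothing=\mathsf t(0)\to\mathsf t(\tfrac12)\to\mathsf t(1)\to\dots\to\mathsf t(r-\tfrac12)\to\mathsf t(r)=\nu$$ such that, for $0\le k<r$, $\mathsf t(k+\frac12)=\mathsf t(k)-\varepsilon_a$ and $\mathsf t(k+1)=\mathsf t(k+\frac12)+\varepsilon_b$ for some $a,b\ge0$; we write $\mathsf t(k)\xrightarrow{-a}\mathsf t(k+\frac12)\xrightarrow{+b}\mathsf t(k+1)$. With $\lambda=\mathsf t(k)$, $\mu=\mathsf t(k+\frac12)$, $\rho=\mathsf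 t(k+1)$, define $$u_{\mathsf t(k)\to\mathsf t(k+\frac12)}=e_{k+\frac12}^{(k-|\mu|)}\,s_{|\lambda|,[\lambda]_a},\qquad u_{\mathsf t(k+\frac12)\to\mathsf t(k+1)}=e_{k+1}^{(k+1-|\rho|)}\Big(\sum_{i=0}^{\rho_b-1}s_{[\rho]_b-i,[\rho]_b}\Big)s_{[\rho]_b,|\rho|},$$ where the sum is read as $1$ if $b=0$, and put $$u_{\mathsf t}=u_{\mathsf t(r-\frac12)\to\mathsf t(r)}\,u_{\mathsf t(r-1)\to\mathsf t(r-\frac12)}\cdots u_{\mathsf t(\frac12)\to\mathsf t(1)}\,u_{\mathsf t(0)\to\mathsf t(\frac12)}\in P_r(n).$$ Let $1\le k<r$ and let $\mathsf t\in\mathrm{Std}_r(\nu)$ have steps $$\mathsf t(k-1)\xrightarrow{-t}\mathsf t(k-\tfrac12)\xrightarrow{+u}\mathsf t(k)\xrightarrow{-v}\mathsf t(k+\tfrac12)\xrightarrow{+w}\mathsf t(k+1).$$ Let $\mathsf t_{k\leftrightarrow k+1}\in\mathrm{Std}_r(\nu)$ be the path, if it exists, that agrees with $\mathsf t$ at all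 levels other than $k-\frac12,k,k+\frac12$ and has steps $-v,+w,-t,+u$ between the levels $k-1$ and $k+1$. If $u=v>0$, let $\mathsf e_k(\mathsf t)\in\mathrm{Std}_r(\nu)$ be the path that agrees with $\mathsf t$ at all levels other than $k$ and has $\mathsf t(k-\frac12)\xrightarrow{+L}\mathsf e_k(\mathsf t)(k)\xrightarrow{-L}\mathsf t(k+\frac12)$, where $L=\ell(\mathsf t(k-\frac12))+1$; otherwise $\mathsf e_k(\mathsf t)$ is undefined. Then, for every $\mathsf t\in\mathrm{Std}_r(\nu)$ such that $\mathsf t_{k\leftrightarrow k+1}$ exists, $$u_{\mathsf t}\,s_{k,k+1}=u_{\mathsf t_{k\leftrightarrow k+1}}+u_{\mathsf e_k(\mathsf t)}-u_{\mathsf e_k(\mathsf t_{k\leftrightarrow k+1})}$$ in $P_r(n)$, where $u_{\mathsf e_k(\mathsf v)}=0$ whenever the path $\mathsf e_k(\mathsf v)$ is undefined. -/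

import Mathlib

namespace PartitionAlg

noncomputable section

/-! ## Gluing equivalence relations along maps -/

/-- The number of classes of `R` which do not meet the image of `g`. -/
def missedClasses {X Z : Type} (R : Setoid X) (g : Z → X) : ℕ :=
  Nat.card {c : Quotient R // ∀ z, Quotient.mk R (g z) ≠ c}

lemma map_le_iff {X Y : Type} {S : Setoid Y} {f : Y → X} {R : Setoid X} :
    S.map f ≤ R ↔ ∀ y y', S y y' → R (f y) (f y') := by
  constructor
  · intro h y y' hy
    exact h (Setoid.le_comap_map hy)
  · intro h x x' hx
    induction hx with
    | rel _ _ h' =>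
      obtain ⟨a, b, hab, rfl, rfl⟩ := h'
      exact h _ _ hab
    | refl => exact R.refl _
    | symm _ _ _ ih => exact R.symm ih
    | trans _ _ _ _ _ ih ih' => exact R.trans ih ih'

lemma rel_map {X Y : Type} {S : Setoid Y} (f : Y → X) {y y' : Y} (h : S y y') :
    S.map f (f y) (f y') := map_le_iff.1 le_rfl _ _ h

lemma map_map' {X Y Z : Type} (S : Setoid Y) (f : Y → X) (g : X → Z) :
    (S.map f).map g = S.map (g ∘ f) := by
  apply le_antisymm
  · rw [map_le_iff]
    have : S.map f ≤ (S.map (g ∘ f)).comap g := by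
      rw [map_le_iff]; intro y y' h; exact rel_map (g ∘ f) h
    exact fun y y' h => this h
  · rw [map_le_iff]
    intro y y' h
    exact rel_map g (rel_map f h)

lemma map_sup' {X Y : Type} (S T : Setoid Y) (f : Y → X) :
    (S ⊔ T).map f = S.map f ⊔ T.map f := by
  apply le_antisymm
  · have : S ⊔ T ≤ (S.map f ⊔ T.map f).comap f := by
      apply sup_le
      · intro y y' h
        exact (le_sup_left : S.map f ≤ S.map f ⊔ T.map f) (rel_map f h)
      · intro y y' h
        exact (le_sup_right : T.map f ≤ S.map f ⊔ T.map f) (rel_map f h)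
    exact map_le_iff.2 fun y y' h => this h
  · apply sup_le <;> rw [map_le_iff] <;> intro y y' h <;> apply rel_map
    · exact (le_sup_left : S ≤ S ⊔ T) h
    · exact (le_sup_right : T ≤ S ⊔ T) h

lemma map_rel_of_injective {X Y : Type} {S : Setoid Y} {f : Y → X} (hf : f.Injective) {x x' : X} :
    S.map f x x' ↔ x = x' ∨ ∃ y y', f y = x ∧ f y' = x' ∧ S y y' := by
  constructor
  · intro h
    induction h with
    | rel _ _ h' =>
      obtain ⟨a, b, hab, rfl, rfl⟩ := h'
      exact Or.inr ⟨a, b, rfl, rfl, hab⟩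
    | refl => exact Or.inl rfl
    | symm _ _ _ ih =>
      rcases ih with rfl | ⟨y, y', rfl, rfl, h⟩
      · exact Or.inl rfl
      · exact Or.inr ⟨y', y, rfl, rfl, S.symm h⟩
    | trans _ _ _ _ _ ih ih' =>
      rcases ih with rfl | ⟨y, y', rfl, rfl, h⟩
      · exact ih'
      · rcases ih' with rfl | ⟨z, z', hz, rfl, h'⟩
        · exact Or.inr ⟨y, y', rfl, rfl, h⟩
        · rw [hf hz] at h'
          exact Or.inr ⟨y, z', rfl, rfl, S.trans h h'⟩
  · rintro (rfl | ⟨y, y', rfl, rfl, h⟩)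
    · exact Setoid.refl' _ _
    · exact rel_map f h

lemma sup_map_rel {X Y : Type} (R : Setoid X) (S : Setoid Y) (f : Y → X) {x x' : X} :
    (R ⊔ S.map f) x x' ↔
      R x x' ∨ ∃ y y', R x (f y) ∧ (R.comap f ⊔ S) y y' ∧ R (f y') x' := by
  set T := R.comap f ⊔ S with hT
  have hRT : ∀ {y y'}, R (f y) (f y') → T y y' := fun h =>
    (le_sup_left : R.comap f ≤ T) h
  constructor
  · let J : Setoid X :=
      { r := fun x x' => R x x' ∨ ∃ y y', R x (f y) ∧ T y y' ∧ R (f y') x'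
        iseqv :=
          { refl := fun x => Or.inl (R.refl x)
            symm := by
              rintro x x' (h | ⟨y, y', h1, h2, h3⟩)
              · exact Or.inl (R.symm h)
              · exact Or.inr ⟨y', y, R.symm h3, T.symm h2, R.symm h1⟩
            trans := by
              rintro a b c (h | ⟨y, y', h1, h2, h3⟩) (h' | ⟨z, z', k1, k2, k3⟩)
              · exact Or.inl (R.trans h h')
              · exact Or.inr ⟨z, z', R.trans h k1, k2, k3⟩
              · exact Or.inr ⟨y, y', h1, h2, R.trans h3 h'⟩
              · exact Or.inr ⟨y, z', h1,
                  T.trans h2 (T.trans (hRT (R.trans h3 k1)) k2), k3⟩ } }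
    have hJ : R ⊔ S.map f ≤ J := by
      apply sup_le
      · intro a b h
        exact Or.inl h
      · rw [map_le_iff]
        intro y y' h
        exact Or.inr ⟨y, y', R.refl _, (le_sup_right : S ≤ T) h, R.refl _⟩
    exact fun h => hJ h
  · have h1 : ∀ {a b}, R a b → (R ⊔ S.map f) a b := fun h =>
      (le_sup_left : R ≤ R ⊔ S.map f) h
    have h2 : T ≤ (R ⊔ S.map f).comap f := by
      apply sup_le
      · intro a b h
        exact h1 h
      · intro a b h
        exact (le_sup_right : S.map f ≤ R ⊔ S.map f) (rel_map f h)
    rintro (h | ⟨y, y', k1, k2, k3⟩)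
    · exact h1 h
    · exact Setoid.trans' _ (h1 k1) (Setoid.trans' _ (h2 k2) (h1 k3))

lemma comap_sup_map {X Y : Type} (R : Setoid X) (S : Setoid Y) (f : Y → X) :
    (R ⊔ S.map f).comap f = R.comap f ⊔ S := by
  ext y y'
  rw [Setoid.comap_rel, sup_map_rel]
  have hRT : ∀ {y y'}, R (f y) (f y') → (R.comap f ⊔ S) y y' := fun h =>
    (le_sup_left : R.comap f ≤ R.comap f ⊔ S) h
  constructor
  · rintro (h | ⟨z, z', k1, k2, k3⟩)
    · exact hRT h
    · exact Setoid.trans' _ (hRT k1) (Setoid.trans' _ k2 (hRT k3))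
  · intro h
    exact Or.inr ⟨y, y', R.refl _, h, R.refl _⟩

lemma missedClasses_sup_map {X Y Z : Type} [Finite X] [Finite Y] (R : Setoid X) (S : Setoid Y)
    (f : Y → X) (g : Z → Y) :
    missedClasses (R ⊔ S.map f) (f ∘ g) = missedClasses R f + missedClasses (R.comap f ⊔ S) g := by
  have hf : ∀ y y', (R ⊔ S.map f) (f y) (f y') ↔ (R.comap f ⊔ S) y y' := fun y y' => by
    rw [← comap_sup_map R S f]; rfl
  have hR : ∀ {a b}, R a b → (R ⊔ S.map f) a b := fun h =>
      (le_sup_left : R ≤ R ⊔ S.map f) h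
  unfold missedClasses
  rw [← Nat.card_sum]
  symm
  let φ : Quotient R → Quotient (R ⊔ S.map f) := Quotient.map id fun a b h => hR h
  let ψ : Quotient (R.comap f ⊔ S) → Quotient (R ⊔ S.map f) :=
    Quotient.map f fun a b h => (hf a b).2 h
  have key : ∀ (x : X) (y : Y), (∀ z, Quotient.mk R (f z) ≠ Quotient.mk R x) →
      ¬ (R ⊔ S.map f) x (f y) := by
    intro x y hx h
    rcases (sup_map_rel R S f).1 h with h | ⟨a, b, h1, -, -⟩
    · exact hx y (Quotient.sound (R.symm h))
    · exact hx a (Quotient.sound (R.symm h1))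
  refine Nat.card_congr (Equiv.ofBijective
    (fun s => Sum.elim
      (fun c => (⟨φ c.1, ?_⟩ : {c : Quotient (R ⊔ S.map f) //
        ∀ z, Quotient.mk (R ⊔ S.map f) ((f ∘ g) z) ≠ c}))
      (fun c => ⟨ψ c.1, ?_⟩) s) ⟨?_, ?_⟩)
  · obtain ⟨c, hc⟩ := c
    induction c using Quotient.inductionOn with | _ x
    intro z h
    exact key x (g z) hc (Setoid.symm' _ (Quotient.exact h))
  · obtain ⟨c, hc⟩ := c
    induction c using Quotient.inductionOn with | _ y
    intro z h
    exact hc z (Quotient.sound ((hf _ _).1 (Quotient.exact h)))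
  · rintro (⟨c, hc⟩ | ⟨c, hc⟩) (⟨d, hd⟩ | ⟨d, hd⟩) h <;>
      induction c using Quotient.inductionOn with | _ x <;>
      induction d using Quotient.inductionOn with | _ y <;>
      have h' := Quotient.exact (congrArg Subtype.val h)
    · rcases (sup_map_rel R S f).1 h' with h' | ⟨a, b, h1, -, -⟩
      · congr 2; exact Quotient.sound h'
      · exact absurd (Quotient.sound (R.symm h1)) (hc a)
    · exact absurd h' (key _ _ hc)
    · exact absurd (Setoid.symm' _ h') (key _ _ hd)
    · congr 2; exact Quotient.sound ((hf _ _).1 h')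
  · rintro ⟨c, hc⟩
    induction c using Quotient.inductionOn with | _ x
    by_cases hx : ∀ z, Quotient.mk R (f z) ≠ Quotient.mk R x
    · exact ⟨Sum.inl ⟨Quotient.mk R x, hx⟩, rfl⟩
    · push Not at hx
      obtain ⟨y, hy⟩ := hx
      have hy' : (R ⊔ S.map f) (f y) x := hR (Quotient.exact hy)
      refine ⟨Sum.inr ⟨Quotient.mk _ y, fun z h => hc z (Quotient.sound ?_)⟩, ?_⟩
      · exact Setoid.trans' _ ((hf _ _).2 (Quotient.exact h)) hy'
      · exact Subtype.ext (Quotient.sound hy')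

/-- A square of injections `j ∘ o = f ∘ u` which is a pullback and jointly covers `X`. -/
structure GlueSquare {X Y₁ Y₂ Z : Type} (j : Y₁ → X) (f : Y₂ → X) (o : Z → Y₁) (u : Z → Y₂) :
    Prop where
  inj_j : j.Injective
  inj_u : u.Injective
  inj_f : f.Injective
  comm : ∀ z, j (o z) = f (u z)
  pull : ∀ a b, j a = f b → ∃ z, o z = a ∧ u z = b
  cover : ∀ x, (∃ a, j a = x) ∨ ∃ b, f b = x

lemma GlueSquare.comap_map {X Y₁ Y₂ Z : Type} {j : Y₁ → X} {f : Y₂ → X} {o : Z → Y₁} {u : Z → Y₂}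
    (h : GlueSquare j f o u) (S : Setoid Y₁) : (S.map j).comap f = (S.comap o).map u := by
  ext b b'
  rw [Setoid.comap_rel, map_rel_of_injective h.inj_j, map_rel_of_injective h.inj_u]
  constructor
  · rintro (e | ⟨a, a', e, e', k⟩)
    · exact Or.inl (h.inj_f e)
    · obtain ⟨z, rfl, rfl⟩ := h.pull _ _ e
      obtain ⟨z', rfl, rfl⟩ := h.pull _ _ e'
      exact Or.inr ⟨z, z', rfl, rfl, k⟩
  · rintro (rfl | ⟨z, z', rfl, rfl, k⟩)
    · exact Or.inl rfl
    · exact Or.inr ⟨o z, o z', h.comm _, h.comm _, k⟩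

lemma GlueSquare.missedClasses_map {X Y₁ Y₂ Z : Type} {j : Y₁ → X} {f : Y₂ → X} {o : Z → Y₁}
    {u : Z → Y₂} (h : GlueSquare j f o u) (S : Setoid Y₁) :
    missedClasses (S.map j) f = missedClasses S o := by
  unfold missedClasses
  symm
  have hj : ∀ a a', S.map j (j a) (j a') ↔ S a a' := fun a a' => by
    conv_rhs => rw [← Setoid.comap_map_eq j S h.inj_j]
    rfl
  let φ : Quotient S → Quotient (S.map j) := Quotient.map j fun a b h' => (hj a b).2 h'
  refine Nat.card_congr (Equiv.ofBijective
    (fun c => (⟨φ c.1, ?_⟩ : {c : Quotient (S.map j) //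
        ∀ z, Quotient.mk (S.map j) (f z) ≠ c})) ⟨?_, ?_⟩)
  · obtain ⟨c, hc⟩ := c
    induction c using Quotient.inductionOn with | _ a
    intro b e
    have e' : S.map j (f b) (j a) := Quotient.exact e
    rw [map_rel_of_injective h.inj_j] at e'
    rcases e' with e' | ⟨y, y', e1, e2, k⟩
    · obtain ⟨z, rfl, -⟩ := h.pull _ _ e'.symm
      exact hc z rfl
    · obtain ⟨z, rfl, -⟩ := h.pull _ _ e1
      rw [h.inj_j e2] at k
      exact hc z (Quotient.sound k)
  · rintro ⟨c, hc⟩ ⟨d, hd⟩ e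
    induction c using Quotient.inductionOn with | _ x
    induction d using Quotient.inductionOn with | _ y
    have e' := Quotient.exact (congrArg Subtype.val e)
    congr 1
    exact Quotient.sound ((hj _ _).1 e')
  · rintro ⟨c, hc⟩
    induction c using Quotient.inductionOn with | _ x
    rcases h.cover x with ⟨a, rfl⟩ | ⟨b, rfl⟩
    · refine ⟨⟨Quotient.mk _ a, fun z e => hc (u z) ?_⟩, rfl⟩
      rw [← h.comm]
      exact Quotient.sound ((hj _ _).2 (Quotient.exact e))
    · exact absurd rfl (hc b)

lemma GlueSquare.glue {X Y₁ Y₂ Z W : Type} [Finite X] [Finite Y₂] {j : Y₁ → X} {f : Y₂ → X}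
    {o : Z → Y₁} {u : Z → Y₂} (h : GlueSquare j f o u) (S : Setoid Y₁) (S' : Setoid Y₂)
    (g : W → Y₂) :
    (S.map j ⊔ S'.map f).comap (f ∘ g) = ((S.comap o).map u ⊔ S').comap g ∧
    missedClasses (S.map j ⊔ S'.map f) (f ∘ g) =
      missedClasses S o + missedClasses ((S.comap o).map u ⊔ S') g := by
  rw [Setoid.comap_comp, comap_sup_map, missedClasses_sup_map, h.comap_map, h.missedClasses_map]
  exact ⟨rfl, rfl⟩

/-! ## Partition diagrams -/

/-- The vertices of a partition diagram: `Sum.inl i` is the northern vertex (barred `i + 1`) and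
`Sum.inr i` is the southern vertex `i + 1`. -/
abbrev Vertex (r : ℕ) : Type := Fin r ⊕ Fin r

/-- A set-partition of the `2 r` vertices, as an equivalence relation. -/
abbrev Diagram (r : ℕ) : Type := Setoid (Vertex r)

/-- The vertices of two diagrams stacked on top of each other: top, middle, bottom. -/
abbrev StackVertex (r : ℕ) : Type := Fin r ⊕ (Fin r ⊕ Fin r)

/-- The position of the vertices of the upper diagram. -/
def upper {r : ℕ} : Vertex r → StackVertex r := Sum.elim Sum.inl (Sum.inr ∘ Sum.inl)

/-- The position of the vertices of the lower diagram. -/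
def lower {r : ℕ} : Vertex r → StackVertex r := Sum.inr

/-- The position of the vertices of the product. -/
def outer {r : ℕ} : Vertex r → StackVertex r := Sum.elim Sum.inl (Sum.inr ∘ Sum.inr)

/-- The connected components of the concatenation of `x` above `y`. -/
abbrev stack {r : ℕ} (x y : Diagram r) : Setoid (StackVertex r) := x.map upper ⊔ y.map lower

/-- The concatenation of `x` above `y`, with the middle components removed. -/
abbrev Diagram.comp {r : ℕ} (x y : Diagram r) : Diagram r := (stack x y).comap outer

/-- The number of connected components consisting only of middle vertices in the concatenation
of `x` above `y`. -/
def Diagram.loops {r : ℕ} (x y : Diagram r) : ℕ := missedClasses (stack x y) outer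

/-- The diagram with blocks `{i, i̅}`. -/
abbrev Diagram.id (r : ℕ) : Diagram r := Setoid.ker (Sum.elim (fun i => i) (fun i => i))

lemma comp_assoc_aux {r : ℕ} (x y z : Diagram r) :
    (x.comp y).comp z = x.comp (y.comp z) ∧
      x.loops y + (x.comp y).loops z = y.loops z + x.loops (y.comp z) := by
  let T : Fin r → Fin r ⊕ (Fin r ⊕ (Fin r ⊕ Fin r)) := Sum.inl
  let M : Fin r → Fin r ⊕ (Fin r ⊕ (Fin r ⊕ Fin r)) := Sum.inr ∘ Sum.inl
  let N : Fin r → Fin r ⊕ (Fin r ⊕ (Fin r ⊕ Fin r)) := Sum.inr ∘ Sum.inr ∘ Sum.inl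
  let B : Fin r → Fin r ⊕ (Fin r ⊕ (Fin r ⊕ Fin r)) := Sum.inr ∘ Sum.inr ∘ Sum.inr
  have h1 : GlueSquare (Sum.elim T (Sum.elim M N)) (Sum.elim T (Sum.elim N B))
      (outer (r := r)) upper := by
    constructor
    · rintro (a | a | a) (b | b | b) <;> simp [T, M, N]
    · rintro (a | a) (b | b) <;> simp [upper]
    · rintro (a | a | a) (b | b | b) <;> simp [T, B, N]
    · rintro (a | a) <;> simp [upper, outer]
    · rintro (a | a | a) (b | b | b) <;> simp [upper, outer, T, M, N, B]
    · rintro (a | a | a | a) <;> simp [T, M, N, B]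
  have h2 : GlueSquare (Sum.elim M (Sum.elim N B)) (Sum.elim T (Sum.elim M B))
      (outer (r := r)) lower := by
    constructor
    · rintro (a | a | a) (b | b | b) <;> simp [M, N, B]
    · rintro (a | a) (b | b) <;> simp [lower]
    · rintro (a | a | a) (b | b | b) <;> simp [T, B, M]
    · rintro (a | a) <;> simp [lower, outer]
    · rintro (a | a | a) (b | b | b) <;> simp [lower, outer, T, M, N, B, eq_comm]
    · rintro (a | a | a | a) <;> simp [T, M, N, B]
  have g1 := h1.glue (stack x y) (z.map lower) outer
  have g2 := h2.glue (stack y z) (x.map upper) outer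
  have e0 : Sum.elim T (Sum.elim N B) ∘ outer = Sum.elim T (Sum.elim M B) ∘ outer := by
    ext (a | a) <;> rfl
  have e1 : Sum.elim T (Sum.elim M N) ∘ upper = Sum.elim T (Sum.elim M B) ∘ upper := by
    ext (a | a) <;> rfl
  have e2 : Sum.elim T (Sum.elim M N) ∘ lower = Sum.elim M (Sum.elim N B) ∘ upper := by
    ext (a | a) <;> rfl
  have e3 : Sum.elim T (Sum.elim N B) ∘ lower = Sum.elim M (Sum.elim N B) ∘ lower := by
    ext (a | a) <;> rfl
  have e : (stack x y).map (Sum.elim T (Sum.elim M N)) ⊔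
        (z.map lower).map (Sum.elim T (Sum.elim N B)) =
      (stack y z).map (Sum.elim M (Sum.elim N B)) ⊔
        (x.map upper).map (Sum.elim T (Sum.elim M B)) := by
    simp only [stack, map_sup', map_map', e1, e2, e3]
    rw [sup_assoc, sup_comm]
  rw [e, e0] at g1
  have p1 : (((stack x y).comap outer).map upper ⊔ z.map lower) = stack (x.comp y) z := rfl
  have p2 : (((stack y z).comap outer).map lower ⊔ x.map upper) = stack x (y.comp z) := by
    rw [sup_comm]
  rw [p1] at g1
  rw [p2] at g2
  exact ⟨g1.1.symm.trans g2.1, g1.2.symm.trans g2.2⟩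

lemma comp_unit_aux {r : ℕ} (x : Diagram r) (E : Setoid (StackVertex r))
    (f : Vertex r → StackVertex r) (c : StackVertex r → Vertex r) (hcf : ∀ v, c (f v) = v)
    (hE : E ≤ Setoid.ker c) (hf : ∀ v, E (outer v) (f v)) (ho : ∀ a, ∃ v, E (outer v) a) :
    (E ⊔ x.map f).comap outer = x ∧ missedClasses (E ⊔ x.map f) outer = 0 := by
  have hJ : ∀ {a b}, E a b → (E ⊔ x.map f) a b := fun h => (le_sup_left : E ≤ E ⊔ x.map f) h
  have hc : (E ⊔ x.map f).comap f = x := by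
    rw [comap_sup_map]
    apply sup_eq_right.2
    intro v w h
    have h' : c (f v) = c (f w) := hE h
    rw [hcf, hcf] at h'
    rw [h']
  constructor
  · refine Eq.trans ?_ hc
    ext v w
    change (E ⊔ x.map f) (outer v) (outer w) ↔ (E ⊔ x.map f) (f v) (f w)
    constructor
    · intro h
      exact Setoid.trans' _ (Setoid.symm' _ (hJ (hf v))) (Setoid.trans' _ h (hJ (hf w)))
    · intro h
      exact Setoid.trans' _ (hJ (hf v)) (Setoid.trans' _ h (Setoid.symm' _ (hJ (hf w))))
  · unfold missedClasses
    rw [Nat.card_eq_zero]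
    left
    constructor
    rintro ⟨q, hq⟩
    induction q using Quotient.inductionOn with | _ a
    obtain ⟨v, hv⟩ := ho a
    exact hq v (Quotient.sound (hJ hv))

lemma id_comp_aux {r : ℕ} (x : Diagram r) :
    (Diagram.id r).comp x = x ∧ (Diagram.id r).loops x = 0 := by
  have hm : ∀ a : Fin r, ((Diagram.id r).map upper) (Sum.inl a) (Sum.inr (Sum.inl a)) := fun a =>
    rel_map upper (y := Sum.inl a) (y' := Sum.inr a) rfl
  refine comp_unit_aux x ((Diagram.id r).map upper) lower
    (Sum.elim Sum.inl _root_.id) ?_ ?_ ?_ ?_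
  · rintro (a | a) <;> rfl
  · rw [map_le_iff]
    rintro (a | a) (b | b) h <;> exact congrArg Sum.inl h
  · rintro (a | a)
    · exact hm a
    · exact Setoid.refl' _ _
  · rintro (a | a | a)
    · exact ⟨Sum.inl a, Setoid.refl' _ _⟩
    · exact ⟨Sum.inl a, hm a⟩
    · exact ⟨Sum.inr a, Setoid.refl' _ _⟩

lemma comp_id_aux {r : ℕ} (x : Diagram r) :
    x.comp (Diagram.id r) = x ∧ x.loops (Diagram.id r) = 0 := by
  have hm : ∀ a : Fin r, ((Diagram.id r).map lower) (Sum.inr (Sum.inr a)) (Sum.inr (Sum.inl a)) :=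
    fun a => rel_map lower (y := Sum.inr a) (y' := Sum.inl a) rfl
  have := comp_unit_aux x ((Diagram.id r).map lower) upper
    (Sum.elim Sum.inl (Sum.elim Sum.inr Sum.inr)) ?_ ?_ ?_ ?_
  · rw [sup_comm] at this
    exact this
  · rintro (a | a) <;> rfl
  · rw [map_le_iff]
    rintro (a | a) (b | b) h <;> exact congrArg Sum.inr h
  · rintro (a | a)
    · exact Setoid.refl' _ _
    · exact hm a
  · rintro (a | a | a)
    · exact ⟨Sum.inl a, Setoid.refl' _ _⟩
    · exact ⟨Sum.inr a, hm a⟩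
    · exact ⟨Sum.inr a, Setoid.refl' _ _⟩

/-! ## The partition algebra -/

/-- The bilinear map with `(x, y) ↦ n ^ loops x y • comp x y` on pairs of diagrams. -/
def diagramMul (r n : ℕ) : (Diagram r →₀ ℚ) →ₗ[ℚ] (Diagram r →₀ ℚ) →ₗ[ℚ] (Diagram r →₀ ℚ) :=
  Finsupp.linearCombination ℚ fun x : Diagram r =>
    Finsupp.linearCombination ℚ fun y : Diagram r =>
      Finsupp.single (x.comp y) ((n : ℚ) ^ x.loops y)

lemma diagramMul_single {r : ℕ} (n : ℕ) (x y : Diagram r) (a b : ℚ) :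
    diagramMul r n (Finsupp.single x a) (Finsupp.single y b) =
      Finsupp.single (x.comp y) (a * b * (n : ℚ) ^ x.loops y) := by
  simp only [diagramMul, Finsupp.linearCombination_single, LinearMap.smul_apply,
    Finsupp.smul_single, smul_eq_mul, mul_assoc]

lemma diagramMul_assoc {r : ℕ} (n : ℕ) (a b c : Diagram r →₀ ℚ) :
    diagramMul r n (diagramMul r n a b) c = diagramMul r n a (diagramMul r n b c) := by
  induction a using Finsupp.induction_linear with
  | zero => simp
  | add a a' ha ha' => simp only [map_add, LinearMap.add_apply, ha, ha']
  | single x p =>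
    induction b using Finsupp.induction_linear with
    | zero => simp
    | add b b' hb hb' => simp only [map_add, LinearMap.add_apply, hb, hb']
    | single y q =>
      induction c using Finsupp.induction_linear with
      | zero => simp
      | add c c' hc hc' => simp only [map_add, hc, hc']
      | single z t =>
        obtain ⟨h1, h2⟩ := comp_assoc_aux x y z
        simp only [diagramMul_single]
        rw [h1]
        congr 1
        have h3 : (n : ℚ) ^ x.loops y * (n : ℚ) ^ (x.comp y).loops z =
            (n : ℚ) ^ y.loops z * (n : ℚ) ^ x.loops (y.comp z) := by
          rw [← pow_add, ← pow_add, h2]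
        linear_combination p * q * t * h3

lemma diagramMul_id_left {r : ℕ} (n : ℕ) (a : Diagram r →₀ ℚ) :
    diagramMul r n (Finsupp.single (Diagram.id r) 1) a = a := by
  induction a using Finsupp.induction_linear with
  | zero => simp
  | add a a' ha ha' => rw [map_add, ha, ha']
  | single x p =>
    obtain ⟨h1, h2⟩ := id_comp_aux x
    rw [diagramMul_single, h1, h2]
    simp

lemma diagramMul_id_right {r : ℕ} (n : ℕ) (a : Diagram r →₀ ℚ) :
    diagramMul r n a (Finsupp.single (Diagram.id r) 1) = a := by
  induction a using Finsupp.induction_linear with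
  | zero => simp
  | add a a' ha ha' => rw [map_add, LinearMap.add_apply, ha, ha']
  | single x p =>
    obtain ⟨h1, h2⟩ := comp_id_aux x
    rw [diagramMul_single, h1, h2]
    simp

/-- The partition algebra `P_r(n)` over `ℚ`: the vector space with basis the set-partitions of the
`2 r` vertices, and multiplication `diagramMul`. -/
def PartitionAlgebra (r _n : ℕ) : Type := Diagram r →₀ ℚ

instance (r n : ℕ) : AddCommGroup (PartitionAlgebra r n) :=
  inferInstanceAs (AddCommGroup (Diagram r →₀ ℚ))

instance (r n : ℕ) : Module ℚ (PartitionAlgebra r n) :=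
  inferInstanceAs (Module ℚ (Diagram r →₀ ℚ))

/-- The basis element of `P_r(n)` given by a diagram. -/
def diagram {r : ℕ} (n : ℕ) (x : Diagram r) : PartitionAlgebra r n := Finsupp.single x (1 : ℚ)

instance (r n : ℕ) : Ring (PartitionAlgebra r n) where
  mul a b := diagramMul r n a b
  one := diagram n (Diagram.id r)
  mul_assoc := diagramMul_assoc n
  one_mul := diagramMul_id_left n
  mul_one := diagramMul_id_right n
  left_distrib a b c := (diagramMul r n a).map_add b c
  right_distrib a b c := (diagramMul r n).map_add₂ a b c
  zero_mul a := (diagramMul r n).map_zero₂ a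
  mul_zero a := (diagramMul r n a).map_zero
  neg_add_cancel := neg_add_cancel
  zsmul := fun z a => z • a
  zsmul_zero' := SubNegMonoid.zsmul_zero'
  zsmul_succ' := SubNegMonoid.zsmul_succ'
  zsmul_neg' := SubNegMonoid.zsmul_neg'
  nsmul := fun z a => z • a
  nsmul_zero := AddMonoid.nsmul_zero
  nsmul_succ := AddMonoid.nsmul_succ
  sub_eq_add_neg := sub_eq_add_neg

instance (r n : ℕ) : Algebra ℚ (PartitionAlgebra r n) :=
  Algebra.ofModule (fun c a b => (diagramMul r n).map_smul₂ c a b)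
    (fun c a b => (diagramMul r n a).map_smul c b)

lemma diagram_mul_diagram {r : ℕ} (n : ℕ) (x y : Diagram r) :
    diagram n x * diagram n y = (n : ℚ) ^ x.loops y • diagram n (x.comp y) := by
  refine (diagramMul_single n x y 1 1).trans ?_
  change _ = (n : ℚ) ^ x.loops y • (Finsupp.single (x.comp y) (1 : ℚ) : Diagram r →₀ ℚ)
  rw [one_mul, one_mul, Finsupp.smul_single, smul_eq_mul, mul_one]

/-! ## Generators -/

/-- The diagram whose blocks are the fibres of a colouring: the northern vertex (barred) `j` has
colour `top j` and the southern vertex `j` has colour `bot j`, for `1 ≤ j ≤ r`. -/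
abbrev colourDiagram (r : ℕ) (top bot : ℕ → ℕ) : Diagram r :=
  Setoid.ker (Sum.elim (fun i : Fin r => top (i + 1)) (fun i : Fin r => bot (i + 1)))

/-- The Coxeter generator `s_{k,k+1}` for `1 ≤ k < r`. -/
def sGen (r n k : ℕ) : PartitionAlgebra r n :=
  diagram n (colourDiagram r (fun j => Equiv.swap k (k + 1) j) (fun j => j))

/-- The generator `p_k` for `1 ≤ k ≤ r`: the vertices (barred) `k` and `k` are isolated. -/
def pGen (r n k : ℕ) : PartitionAlgebra r n :=
  diagram n (colourDiagram r (fun j => j) (fun j => if j = k then 0 else j))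

/-- The generator `p_{k+1/2}` for `1 ≤ k < r`: the vertices `k`, `k + 1` and their barred versions
form one block. -/
def pHalfGen (r n k : ℕ) : PartitionAlgebra r n :=
  diagram n (colourDiagram r (fun j => if j = k + 1 then k else j)
    (fun j => if j = k + 1 then k else j))

/-- `e_k^{(l)} = p_{k-l+1} ⋯ p_{k-1} p_k`, with `l ≤ k` factors. -/
def eInt (r n k l : ℕ) : PartitionAlgebra r n :=
  ((List.range l).map fun i => pGen r n (k - l + 1 + i)).prod

/-- `e_{k+1/2}^{(l)} = p_{k-l+3/2} ⋯ p_{k-1/2} p_{k+1/2}`, with `l ≤ k` factors. -/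
def eHalf (r n k l : ℕ) : PartitionAlgebra r n :=
  ((List.range l).map fun i => pHalfGen r n (k - l + 1 + i)).prod

/-- `s_{l,k} = s_l s_{l+1} ⋯ s_{k-1}` for `l ≤ k`; it is the inverse
`s_{k,l}⁻¹ = s_{l-1} ⋯ s_{k+1} s_k` for `k < l`, and `1` if `l = 0` or `k = 0`. -/
def sTrans (r n l k : ℕ) : PartitionAlgebra r n :=
  if l = 0 ∨ k = 0 then 1
  else if l ≤ k then ((List.range (k - l)).map fun i => sGen r n (l + i)).prod
  else ((List.range (l - k)).map fun i => sGen r n (k + i)).reverse.prod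

lemma sGen_mul_self {r n k : ℕ} (h1 : 1 ≤ k) (hr : k < r) : sGen r n k * sGen r n k = 1 := by
  set x : Diagram r := colourDiagram r (fun j => Equiv.swap k (k + 1) j) (fun j => j) with hx
  have hsw : ∀ i : Fin r, ∃ i' : Fin r, ((i' : ℕ) + 1) = Equiv.swap k (k + 1) ((i : ℕ) + 1) := by
    intro i
    have hi := i.2
    by_cases e1 : (i : ℕ) + 1 = k
    · exact ⟨⟨k, hr⟩, by rw [e1, Equiv.swap_apply_left]⟩
    · by_cases e2 : (i : ℕ) + 1 = k + 1
      · exact ⟨⟨k - 1, by omega⟩, by rw [e2, Equiv.swap_apply_right]; simp only; omega⟩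
      · exact ⟨i, by rw [Equiv.swap_apply_of_ne_of_ne e1 e2]⟩
  choose τ hτ using hsw
  have hττ : ∀ i, τ (τ i) = i := by
    intro i
    apply Fin.ext
    have := hτ (τ i)
    rw [hτ i, Equiv.swap_apply_self] at this
    omega
  have hm : ∀ i : Fin r, stack x x (Sum.inr (Sum.inl i)) (Sum.inl (τ i)) := by
    intro i
    refine Setoid.symm' _ ((le_sup_left : x.map upper ≤ stack x x)
      (rel_map upper (y := Sum.inl (τ i)) (y' := Sum.inr i) ?_))
    change Equiv.swap k (k + 1) ((τ i : ℕ) + 1) = (i : ℕ) + 1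
    rw [hτ, Equiv.swap_apply_self]
  have hm' : ∀ i : Fin r, stack x x (Sum.inr (Sum.inr i)) (Sum.inr (Sum.inl (τ i))) := by
    intro i
    refine Setoid.symm' _ ((le_sup_right : x.map lower ≤ stack x x)
      (rel_map lower (y := Sum.inl (τ i)) (y' := Sum.inr i) ?_))
    change Equiv.swap k (k + 1) ((τ i : ℕ) + 1) = (i : ℕ) + 1
    rw [hτ, Equiv.swap_apply_self]
  have hb : ∀ i : Fin r, stack x x (Sum.inr (Sum.inr i)) (Sum.inl i) := by
    intro i
    have := Setoid.trans' _ (hm' i) (hm (τ i))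
    rwa [hττ] at this
  have hle : stack x x ≤ Setoid.ker (Sum.elim (fun i => i) (Sum.elim τ (fun i => i))) := by
    have hval : ∀ i j : Fin r, Equiv.swap k (k + 1) ((i : ℕ) + 1) = (j : ℕ) + 1 → i = τ j := by
      intro i j h
      have h' : ((τ i : ℕ) + 1) = (j : ℕ) + 1 := (hτ i).trans h
      have : τ i = j := Fin.ext (by omega)
      rw [← this, hττ]
    have hval' : ∀ i j : Fin r, Equiv.swap k (k + 1) ((i : ℕ) + 1) =
        Equiv.swap k (k + 1) ((j : ℕ) + 1) → i = j := fun i j h =>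
      Fin.ext (by have := (Equiv.swap k (k + 1)).injective h; omega)
    have hval2 : ∀ i j : Fin r, (i : ℕ) + 1 = (j : ℕ) + 1 → i = j := fun i j h =>
      Fin.ext (by omega)
    apply sup_le <;> rw [map_le_iff]
    · rintro (i | i) (j | j) h
      · exact hval' i j h
      · exact hval i j h
      · exact (hval j i (Eq.symm h)).symm
      · exact congrArg τ (hval2 i j h)
    · rintro (i | i) (j | j) h
      · exact congrArg τ (hval' i j h)
      · have h' := hval i j h
        change τ i = j
        rw [h', hττ]
      · have h' := hval j i (Eq.symm h)
        change i = τ j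
        rw [h', hττ]
      · exact hval2 i j h
  have hcomp : x.comp x = Diagram.id r := by
    have ht : ∀ v : Vertex r, stack x x (outer v) (Sum.inl (Sum.elim _root_.id _root_.id v)) := by
      rintro (i | i)
      · exact Setoid.refl' _ _
      · exact hb i
    ext v w
    constructor
    · intro h
      have := hle h
      rcases v with i | i <;> rcases w with j | j <;> exact this
    · intro h
      have h' : (Sum.elim _root_.id _root_.id v : Fin r) = Sum.elim _root_.id _root_.id w := by
        rcases v with i | i <;> rcases w with j | j <;> exact h
      have := ht v
      rw [h'] at this
      change stack x x (outer v) (outer w)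
      exact Setoid.trans' _ this (Setoid.symm' _ (ht w))
  have hloops : x.loops x = 0 := by
    rw [Diagram.loops, missedClasses, Nat.card_eq_zero]
    left
    constructor
    rintro ⟨q, hq⟩
    induction q using Quotient.inductionOn with | _ a
    rcases a with i | i | i
    · exact hq (Sum.inl i) rfl
    · exact hq (Sum.inl (τ i)) (Quotient.sound (Setoid.symm' _ (hm i)))
    · exact hq (Sum.inr i) rfl
  rw [sGen, diagram_mul_diagram, ← hx, hcomp, hloops, pow_zero, one_smul]
  rfl

lemma sTrans_mul_sTrans {r n l k : ℕ} (hl : l ≤ r) (hk : k ≤ r) :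
    sTrans r n l k * sTrans r n k l = 1 := by
  have key : ∀ (L : List ℕ), (∀ i ∈ L, 1 ≤ i ∧ i < r) →
      (L.map (sGen r n)).prod * (L.map (sGen r n)).reverse.prod = 1 ∧
      (L.map (sGen r n)).reverse.prod * (L.map (sGen r n)).prod = 1 := by
    intro L
    induction L with
    | nil => simp
    | cons a L ih =>
      intro h
      obtain ⟨h1, h2⟩ := ih fun i hi => h i (List.mem_cons_of_mem _ hi)
      have ha := sGen_mul_self (n := n) (h a List.mem_cons_self).1 (h a List.mem_cons_self).2
      simp only [List.map_cons, List.prod_cons, List.reverse_cons, List.prod_append,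
        List.prod_nil, mul_one]
      constructor
      · calc _ = sGen r n a * ((L.map (sGen r n)).prod * (L.map (sGen r n)).reverse.prod) *
              sGen r n a := by noncomm_ring
          _ = 1 := by rw [h1, mul_one, ha]
      · calc _ = (L.map (sGen r n)).reverse.prod * (sGen r n a * sGen r n a) *
              (L.map (sGen r n)).prod := by noncomm_ring
          _ = 1 := by rw [ha, mul_one, h2]
  have key' : ∀ a b, 1 ≤ a → a ≤ b → b ≤ r → sTrans r n a b * sTrans r n b a = 1 ∧
      sTrans r n b a * sTrans r n a b = 1 := by
    intro a b h1 h2 h3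
    rcases h2.eq_or_lt with rfl | h2
    · simp [sTrans]
    · have := key ((List.range (b - a)).map fun i => a + i) (by
        intro i hi
        simp only [List.mem_map, List.mem_range] at hi
        omega)
      rw [List.map_map] at this
      have e1 : ¬ (a = 0 ∨ b = 0) := by omega
      have e2 : ¬ (b = 0 ∨ a = 0) := by omega
      rw [sTrans, sTrans, if_neg e1, if_neg e2, if_pos h2.le, if_neg (by omega)]
      exact this
  by_cases h0 : l = 0 ∨ k = 0
  · rw [sTrans, sTrans, if_pos h0, if_pos h0.symm, mul_one]
  · rcases le_total l k with h | h
    · exact (key' l k (by omega) h hk).1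
    · exact (key' k l (by omega) h hl).2

/-! ## Paths in the branching graph -/

/-- `ν = μ + ε_b`: for `b > 0` the diagram `ν` is obtained from `μ` by adding a box in row `b`
(rows are numbered from `1`), and `ν = μ` for `b = 0`. Equivalently `μ = ν - ε_b`. -/
def IsAddStep (b : ℕ) (μ ν : YoungDiagram) : Prop :=
  ∀ i, ν.rowLen i = μ.rowLen i + if i + 1 = b then 1 else 0

lemma ext_rowLen {μ ν : YoungDiagram} (h : ∀ i, μ.rowLen i = ν.rowLen i) : μ = ν := by
  ext ⟨i, j⟩
  rw [YoungDiagram.mem_cells, YoungDiagram.mem_cells, YoungDiagram.mem_iff_lt_rowLen,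
    YoungDiagram.mem_iff_lt_rowLen, h]

lemma IsAddStep.card_eq {b : ℕ} {μ ν : YoungDiagram} (h : IsAddStep b μ ν) :
    ν.card = μ.card + if b = 0 then 0 else 1 := by
  by_cases hb : b = 0
  · have : ν = μ := ext_rowLen fun i => by rw [h i, if_neg (by omega), add_zero]
    rw [this, if_pos hb, add_zero]
  · have hc : ν.cells = insert (b - 1, μ.rowLen (b - 1)) μ.cells := by
      ext ⟨i, j⟩
      rw [Finset.mem_insert, YoungDiagram.mem_cells, YoungDiagram.mem_cells,
        YoungDiagram.mem_iff_lt_rowLen, YoungDiagram.mem_iff_lt_rowLen, h i, Prod.mk.injEq]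
      by_cases hi : i + 1 = b
      · obtain rfl : i = b - 1 := by omega
        rw [if_pos hi]
        omega
      · rw [if_neg hi]
        have : i ≠ b - 1 := by omega
        simp [this]
    rw [if_neg hb, YoungDiagram.card, hc, Finset.card_insert_of_notMem]
    rw [YoungDiagram.mem_cells, YoungDiagram.mem_iff_lt_rowLen]
    omega

/-- A standard Kronecker tableau of shape `ν` and degree `r`: a path
`∅ = 𝔱(0) → 𝔱(1/2) → 𝔱(1) → ⋯ → 𝔱(r) = ν` in the branching graph of the partition algebras,
recorded with the labels of its edges (which are determined by the vertices). -/
@[ext]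
structure KroneckerTableau (r : ℕ) (ν : YoungDiagram) where
  /-- `shape k` is `𝔱(k)`. -/
  shape : Fin (r + 1) → YoungDiagram
  /-- `half k` is `𝔱(k + 1/2)`. -/
  half : Fin r → YoungDiagram
  /-- `sub k = a` for the edge `𝔱(k) → 𝔱(k + 1/2)` labelled `-a`. -/
  sub : Fin r → ℕ
  /-- `add k = b` for the edge `𝔱(k + 1/2) → 𝔱(k + 1)` labelled `+b`. -/
  add : Fin r → ℕ
  shape_zero : shape 0 = ⊥
  shape_last : shape (Fin.last r) = ν
  step_sub : ∀ k, IsAddStep (sub k) (half k) (shape k.castSucc)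
  step_add : ∀ k, IsAddStep (add k) (half k) (shape k.succ)

namespace KroneckerTableau

variable {r : ℕ} {ν : YoungDiagram}

/-- The vertices of the path lie in the levels `𝒴_k` of the branching graph. -/
lemma card_shape_le (t : KroneckerTableau r ν) (k : Fin (r + 1)) : (t.shape k).card ≤ k := by
  induction k using Fin.induction with
  | zero => rw [t.shape_zero]; simp [YoungDiagram.card]
  | succ k ih =>
    have h1 := (t.step_sub k).card_eq
    have h2 := (t.step_add k).card_eq
    rw [Fin.val_castSucc] at ih
    rw [Fin.val_succ]
    split_ifs at h1 h2 <;> omega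

/-- The vertices of the path lie in the levels `𝒴_{k+1/2}` of the branching graph. -/
lemma card_half_le (t : KroneckerTableau r ν) (k : Fin r) : (t.half k).card ≤ k := by
  have h1 := (t.step_sub k).card_eq
  have h2 := t.card_shape_le k.castSucc
  rw [Fin.val_castSucc] at h2
  omega

end KroneckerTableau

/-! ## The elements `u_𝔱` -/

/-- `[μ]_a = μ_1 + ⋯ + μ_a`. -/
def rowSum (μ : YoungDiagram) (a : ℕ) : ℕ := ∑ i ∈ Finset.range a, μ.rowLen i

/-- `∑_{i=0}^{ν_b - 1} s_{[ν]_b - i, [ν]_b}`, which is read as `1` for `b = 0`. -/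
def rowSymmetrizer (r n : ℕ) (ν : YoungDiagram) (b : ℕ) : PartitionAlgebra r n :=
  if b = 0 then 1
  else ∑ i ∈ Finset.range (ν.rowLen (b - 1)), sTrans r n (rowSum ν b - i) (rowSum ν b)

/-- The up branching coefficient of an edge `-a : lam → μ` from level `k` to level `k + 1/2`. -/
def upSub (r n k : ℕ) (lam μ : YoungDiagram) (a : ℕ) : PartitionAlgebra r n :=
  eHalf r n k (k - μ.card) * sTrans r n lam.card (rowSum lam a)

/-- The up branching coefficient of an edge `+b : μ → ν` from level `k + 1/2` to level `k + 1`. -/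
def upAdd (r n k : ℕ) (ν : YoungDiagram) (b : ℕ) : PartitionAlgebra r n :=
  eInt r n (k + 1) (k + 1 - ν.card) * rowSymmetrizer r n ν b * sTrans r n (rowSum ν b) ν.card

namespace KroneckerTableau

variable {r : ℕ} {ν : YoungDiagram}

/-- `u_𝔱 = u_{𝔱(r-1/2) → 𝔱(r)} ⋯ u_{𝔱(1/2) → 𝔱(1)} u_{𝔱(0) → 𝔱(1/2)}` in `P_r(n)`. -/
def up (n : ℕ) (t : KroneckerTableau r ν) : PartitionAlgebra r n :=
  ((List.finRange r).reverse.map fun k : Fin r =>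
    upAdd r n k (t.shape k.succ) (t.add k) *
      upSub r n k (t.shape k.castSucc) (t.half k) (t.sub k)).prod

/-- `t.IsSwap k t'` says that the path `𝔱_{k ↔ k+1}` exists and equals `t'`: the paths agree at
all levels other than `k` and `k ± 1/2`, and the steps `(-t, +u)`, `(-v, +w)` between the levels
`k - 1`, `k`, `k + 1` of `t` become `(-v, +w)`, `(-t, +u)` in `t'`. -/
structure IsSwap (t : KroneckerTableau r ν) (k : ℕ) (h1 : 1 ≤ k) (hr : k < r)
    (t' : KroneckerTableau r ν) : Prop where
  shape_eq : ∀ l : Fin (r + 1), (l : ℕ) ≠ k → t'.shape l = t.shape l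
  half_eq : ∀ l : Fin r, (l : ℕ) ≠ k - 1 → (l : ℕ) ≠ k → t'.half l = t.half l
  sub_fst : t'.sub ⟨k - 1, by omega⟩ = t.sub ⟨k, hr⟩
  add_fst : t'.add ⟨k - 1, by omega⟩ = t.add ⟨k, hr⟩
  sub_snd : t'.sub ⟨k, hr⟩ = t.sub ⟨k - 1, by omega⟩
  add_snd : t'.add ⟨k, hr⟩ = t.add ⟨k - 1, by omega⟩

end KroneckerTableau

/-- The length `ℓ(μ)`: the number of non-zero rows. -/
def rowCount (μ : YoungDiagram) : ℕ := μ.colLen 0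

/-- `μ + ε_{ℓ(μ) + 1}`: a new row with one box is added to `μ`. -/
def addNewRow (μ : YoungDiagram) : YoungDiagram where
  cells := insert (rowCount μ, 0) μ.cells
  isLowerSet := by
    rintro ⟨i, j⟩ ⟨i', j'⟩ hle h
    obtain ⟨hi, hj⟩ : i' ≤ i ∧ j' ≤ j := hle
    simp only [Finset.coe_insert, Set.mem_insert_iff, Prod.mk.injEq, Finset.mem_coe,
      YoungDiagram.mem_cells] at h ⊢
    rcases h with ⟨rfl, rfl⟩ | h
    · obtain rfl : j' = 0 := by omega
      by_cases e : i' = rowCount μ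
      · exact Or.inl ⟨e, rfl⟩
      · right
        rw [YoungDiagram.mem_iff_lt_colLen]
        exact lt_of_le_of_ne hi e
    · exact Or.inr (μ.up_left_mem hi hj h)

lemma isAddStep_addNewRow (μ : YoungDiagram) :
    IsAddStep (rowCount μ + 1) μ (addNewRow μ) := by
  intro i
  have hmem : ∀ j, (i, j) ∈ addNewRow μ ↔ (i = rowCount μ ∧ j = 0) ∨ (i, j) ∈ μ := by
    intro j
    rw [← YoungDiagram.mem_cells, addNewRow]
    simp
  have hlt : ∀ j, j < (addNewRow μ).rowLen i ↔ (i = rowCount μ ∧ j = 0) ∨ j < μ.rowLen i := by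
    intro j
    rw [← YoungDiagram.mem_iff_lt_rowLen, hmem, YoungDiagram.mem_iff_lt_rowLen]
  have h0 : i = rowCount μ → μ.rowLen i = 0 := by
    rintro rfl
    by_contra h
    have : (rowCount μ, 0) ∈ μ := YoungDiagram.mem_iff_lt_rowLen.2 (Nat.pos_of_ne_zero h)
    rw [YoungDiagram.mem_iff_lt_colLen] at this
    exact lt_irrefl _ this
  have ha := hlt (μ.rowLen i)
  have hb := hlt (μ.rowLen i + 1)
  have hc := hlt (μ.rowLen i - 1)
  by_cases e : i = rowCount μ
  · have := h0 e
    rw [if_pos (by omega)]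
    omega
  · rw [if_neg (by omega)]
    omega

namespace KroneckerTableau

variable {r : ℕ} {ν : YoungDiagram}

/-- The condition `𝔱(k - 1/2) →[+u] 𝔱(k) →[-u] 𝔱(k + 1/2)` with `u > 0` under which `e_k(𝔱)` is
defined. -/
def HasError (t : KroneckerTableau r ν) (k : ℕ) (h1 : 1 ≤ k) (hr : k < r) : Prop :=
  t.add ⟨k - 1, by omega⟩ = t.sub ⟨k, hr⟩ ∧ 0 < t.sub ⟨k, hr⟩

/-- The path `e_k(𝔱)`: it agrees with `𝔱` at all levels other than `k`, and its steps around
the level `k` are `+L` and `-L`, where `L = ℓ(𝔱(k - 1/2)) + 1`. -/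
def errorPath (t : KroneckerTableau r ν) (k : ℕ) (h1 : 1 ≤ k) (hr : k < r)
    (h : t.HasError k h1 hr) : KroneckerTableau r ν where
  shape := Function.update t.shape ⟨k, by omega⟩ (addNewRow (t.half ⟨k - 1, by omega⟩))
  half := t.half
  sub := Function.update t.sub ⟨k, hr⟩ (rowCount (t.half ⟨k - 1, by omega⟩) + 1)
  add := Function.update t.add ⟨k - 1, by omega⟩ (rowCount (t.half ⟨k - 1, by omega⟩) + 1)
  shape_zero := by
    rw [Function.update_of_ne, t.shape_zero]
    intro e
    have := congrArg Fin.val e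
    simp only [Fin.val_zero] at this
    omega
  shape_last := by
    rw [Function.update_of_ne, t.shape_last]
    intro e
    have := congrArg Fin.val e
    simp only [Fin.val_last] at this
    omega
  step_sub := by
    intro i
    by_cases e : i = ⟨k, hr⟩
    · subst e
      have hs : (⟨k, hr⟩ : Fin r).castSucc = ⟨k, by omega⟩ := rfl
      have hhalf : t.half ⟨k, hr⟩ = t.half ⟨k - 1, by omega⟩ := by
        apply ext_rowLen
        intro i
        have a1 := t.step_sub ⟨k, hr⟩ i
        have a2 := t.step_add ⟨k - 1, by omega⟩ i
        have hs' : (⟨k - 1, by omega⟩ : Fin r).succ = (⟨k, hr⟩ : Fin r).castSucc := by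
          apply Fin.ext
          simp only [Fin.val_succ, Fin.val_castSucc]
          omega
        rw [hs', h.1] at a2
        omega
      rw [hs, Function.update_self, Function.update_self, hhalf]
      exact isAddStep_addNewRow _
    · rw [Function.update_of_ne e, Function.update_of_ne]
      · exact t.step_sub i
      · intro e'
        have := congrArg Fin.val e'
        simp only [Fin.val_castSucc] at this
        exact e (Fin.ext this)
  step_add := by
    intro i
    by_cases e : i = ⟨k - 1, by omega⟩
    · subst e
      have hs : (⟨k - 1, by omega⟩ : Fin r).succ = ⟨k, by omega⟩ := by
        apply Fin.ext
        simp only [Fin.val_succ]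
        omega
      rw [hs, Function.update_self, Function.update_self]
      exact isAddStep_addNewRow _
    · rw [Function.update_of_ne e, Function.update_of_ne]
      · exact t.step_add i
      · intro e'
        have := congrArg Fin.val e'
        simp only [Fin.val_succ] at this
        exact e (Fin.ext (by simp only; omega))

open Classical in
/-- `u_{e_k(𝔱)}`, which is `0` whenever the path `e_k(𝔱)` is undefined. -/
def upError (n : ℕ) (t : KroneckerTableau r ν) (k : ℕ) (h1 : 1 ≤ k) (hr : k < r) :
    PartitionAlgebra r n :=
  if h : t.HasError k h1 hr then (t.errorPath k h1 hr h).up n else 0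

end KroneckerTableau

end

end PartitionAlg

/-!
Each `u_𝔱` is a sum of diagrams which can be read off from the path `𝔱`, and no middle component
is ever removed in the products, so that the parameter `n` plays no role.

Consider a diagram of level `k`: its northern vertices `1, …, m` are connected to southern blocks,
the northern vertices `m + 1, …, k` are isolated, and the vertices beyond `k` are joined vertically
(`state`). If `m` is the size of a partition `λ`, the blocks attached to the first `m` vertices form
a filling of the rows of `λ`. The coefficients of the steps `-a, +b` act on it as follows
(`step_mul_state`): the last block is removed from row `a` and the southern vertex `k + 1` joins it
(for `a = 0`, the vertex `k + 1` starts a new block); then the block is inserted into row `b`, and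
the sum over all places in the row is taken (for `b = 0`, the block is dropped).

Two consecutive steps `-t, +u, -v, +w` from level `k` thus give a sum of fillings. If `u = v > 0`,
the first block may have been inserted at the end of row `u`. It is then removed again, and both new
vertices join it. These terms are unchanged by the transposition of the two vertices, and they
make up the contribution of `e_k(𝔱)`, where the block passes through an empty row
(`errorElt_mul_state`). In all other terms, the two vertices join the last blocks of rows `t`
and `v` of the original filling (`insSum_popRow`). Since insertions of different blocks commute
(`insSum_comm`), the transposition exchanges these terms for `𝔱` and `𝔱_{k ↔ k+1}` unless
`t = v > 0` (`mainPart_mul_sGen_of_ne`). When `t = v > 0` it does so only up to an exchange of the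
last two blocks of row `t` (`mainPart_mul_sGen_self`). This is harmless, because the product of the earlier
coefficients is invariant under the row stabilizer of the shape (`isRowInvariant_upTo`): inserting
a block into a row in all possible ways preserves this invariance (`IsRowInvariant.step`).
-/

namespace PartitionAlg

noncomputable section

variable {r n : ℕ}

/-! ### Products of coloured diagrams with the generators -/

/-- A criterion for the product of two diagrams to be a diagram: `γ` is a colouring of the stacked
vertices which is constant on connected components, induces `z` on the outer vertices, and each
middle vertex is connected to an outer one. -/
lemma diagram_mul_eq {r n : ℕ} {C : Type} {x y z : Diagram r} (γ : StackVertex r → C)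
    (hx : ∀ v v', x v v' → γ (upper v) = γ (upper v'))
    (hy : ∀ v v', y v v' → γ (lower v) = γ (lower v'))
    (hz : ∀ v v', γ (outer v) = γ (outer v') → z v v')
    (ho : ∀ v v', z v v' → stack x y (outer v) (outer v'))
    (hm : ∀ i, ∃ v, stack x y (outer v) (Sum.inr (Sum.inl i))) :
    diagram n x * diagram n y = diagram n z := by
  have hle : stack x y ≤ Setoid.ker γ :=
    sup_le (map_le_iff.2 hx) (map_le_iff.2 hy)
  have hcomp : x.comp y = z := by
    ext v w
    exact ⟨fun h => hz v w (hle h), ho v w⟩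
  have hloops : x.loops y = 0 := by
    rw [Diagram.loops, missedClasses, Nat.card_eq_zero]
    left
    constructor
    rintro ⟨q, hq⟩
    induction q using Quotient.inductionOn with | _ a
    rcases a with i | i | i
    · exact hq (Sum.inl i) rfl
    · obtain ⟨v, hv⟩ := hm i
      exact hq v (Quotient.sound hv)
    · exact hq (Sum.inr i) rfl
  rw [diagram_mul_diagram, hcomp, hloops, pow_zero, one_smul]

lemma stack_upper {r : ℕ} {x y : Diagram r} {v v' : Vertex r} (h : x v v') :
    stack x y (upper v) (upper v') :=
  (le_sup_left : x.map upper ≤ stack x y) (rel_map upper h)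

lemma stack_lower {r : ℕ} {x y : Diagram r} {v v' : Vertex r} (h : y v v') :
    stack x y (lower v) (lower v') :=
  (le_sup_right : y.map lower ≤ stack x y) (rel_map lower h)

/-- The diagram whose northern vertex `j` has colour `T j` and whose southern vertex `j` has
colour `B j`, for `1 ≤ j ≤ r`. The colours of the second summand are at the disposal of northern
vertices which are not connected to any southern vertex. -/
def coloured (r n : ℕ) (T : ℕ → ℕ ⊕ ℕ) (B : ℕ → ℕ) : PartitionAlgebra r n :=
  diagram n (Setoid.ker (Sum.elim (fun i : Fin r => T (i + 1))
    (fun i : Fin r => Sum.inl (B (i + 1)))))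

lemma coloured_congr {T T' : ℕ → ℕ ⊕ ℕ} {B B' : ℕ → ℕ} (hT : ∀ j, 1 ≤ j → j ≤ r → T j = T' j)
    (hB : ∀ j, 1 ≤ j → j ≤ r → B j = B' j) : coloured r n T B = coloured r n T' B' := by
  have e1 : (fun i : Fin r => T (i + 1)) = fun i : Fin r => T' (i + 1) :=
    funext fun i => hT _ (by omega) (by omega)
  have e2 : (fun i : Fin r => (Sum.inl (B (i + 1)) : ℕ ⊕ ℕ)) =
      fun i : Fin r => Sum.inl (B' (i + 1)) :=
    funext fun i => congrArg Sum.inl (hB _ (by omega) (by omega))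
  rw [coloured, coloured, e1, e2]

/-- A diagram depends only on the fibres of its colouring. -/
lemma coloured_map {φ : ℕ → ℕ} (hφ : φ.Injective) (T : ℕ → ℕ ⊕ ℕ) (B : ℕ → ℕ) :
    coloured r n (fun j => Sum.map φ _root_.id (T j)) (fun j => φ (B j)) = coloured r n T B := by
  have hi : (Sum.map φ _root_.id : ℕ ⊕ ℕ → ℕ ⊕ ℕ).Injective :=
    hφ.sumMap Function.injective_id
  unfold coloured
  congr 1
  ext v w
  have e : ∀ v : Vertex r, Sum.elim (fun i : Fin r => Sum.map φ _root_.id (T (i + 1)))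
      (fun i : Fin r => (Sum.inl (φ (B (i + 1))) : ℕ ⊕ ℕ)) v = Sum.map φ _root_.id
        (Sum.elim (fun i : Fin r => T (i + 1)) (fun i : Fin r => Sum.inl (B (i + 1))) v) := by
    rintro (v | v) <;> rfl
  rw [Setoid.ker_def, Setoid.ker_def, e, e]
  exact hi.eq_iff

lemma coloured_self_eq_one : coloured r n (fun j => Sum.inl j) (fun j => j) = 1 := by
  change _ = diagram n (Diagram.id r)
  unfold coloured
  congr 1
  ext v w
  rw [Setoid.ker_def, Setoid.ker_def]
  rcases v with v | v <;> rcases w with w | w <;> simp [Fin.ext_iff]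

/-- The permutation of the vertices `Fin r` underlying `s_{i,i+1}`. -/
lemma exists_swap_fin {i : ℕ} (h1 : 1 ≤ i) (hr : i < r) :
    ∃ τ : Fin r → Fin r, (∀ a, ((τ a : ℕ) + 1) = Equiv.swap i (i + 1) ((a : ℕ) + 1)) ∧
      ∀ a, τ (τ a) = a := by
  have hsw : ∀ a : Fin r, ∃ a' : Fin r, ((a' : ℕ) + 1) = Equiv.swap i (i + 1) ((a : ℕ) + 1) := by
    intro a
    have ha := a.2
    by_cases e1 : (a : ℕ) + 1 = i
    · exact ⟨⟨i, hr⟩, by rw [e1, Equiv.swap_apply_left]⟩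
    · by_cases e2 : (a : ℕ) + 1 = i + 1
      · exact ⟨⟨i - 1, by omega⟩, by rw [e2, Equiv.swap_apply_right]; simp only; omega⟩
      · exact ⟨a, by rw [Equiv.swap_apply_of_ne_of_ne e1 e2]⟩
  choose τ hτ using hsw
  refine ⟨τ, hτ, fun a => ?_⟩
  apply Fin.ext
  have := hτ (τ a)
  rw [hτ a, Equiv.swap_apply_self] at this
  omega

lemma sGen_mul_coloured {i : ℕ} (h1 : 1 ≤ i) (hr : i < r) (T : ℕ → ℕ ⊕ ℕ) (B : ℕ → ℕ) :
    sGen r n i * coloured r n T B =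
      coloured r n (fun j => T (Equiv.swap i (i + 1) j)) B := by
  obtain ⟨τ, hτ, hττ⟩ := exists_swap_fin h1 hr
  refine diagram_mul_eq (Sum.elim (fun a : Fin r => T (Equiv.swap i (i + 1) (a + 1)))
    (Sum.elim (fun a : Fin r => T (a + 1)) fun a : Fin r => Sum.inl (B (a + 1)))) ?_ ?_ ?_ ?_ ?_
  · rintro (a | a) (b | b) h <;> rw [Setoid.ker_def] at h <;>
      simp only [Sum.elim_inl, Sum.elim_inr] at h <;>
      simp [upper, h]
  · rintro (a | a) (b | b) h <;> exact h
  · rintro (a | a) (b | b) h <;> exact h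
  · have key : ∀ v : Vertex r, stack (colourDiagram r (fun j => Equiv.swap i (i + 1) j) fun j => j)
        (Setoid.ker (Sum.elim (fun i : Fin r => T (i + 1))
          (fun i : Fin r => Sum.inl (B (i + 1))))) (outer v) (lower (Sum.map τ _root_.id v)) := by
      rintro (a | a)
      · refine stack_upper (v := Sum.inl a) (v' := Sum.inr (τ a)) ?_
        rw [Setoid.ker_def]
        simp [hτ]
      · exact Setoid.refl' _ _
    intro v w h
    refine Setoid.trans' _ (key v) (Setoid.trans' _ (stack_lower ?_) (Setoid.symm' _ (key w)))
    rw [Setoid.ker_def] at h ⊢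
    rcases v with a | a <;> rcases w with b | b <;> simpa [hτ] using h
  · intro a
    refine ⟨Sum.inl (τ a), stack_upper (v := Sum.inl (τ a)) (v' := Sum.inr a) ?_⟩
    rw [Setoid.ker_def]
    simp [hτ]

lemma coloured_mul_sGen {i : ℕ} (h1 : 1 ≤ i) (hr : i < r) (T : ℕ → ℕ ⊕ ℕ) (B : ℕ → ℕ) :
    coloured r n T B * sGen r n i =
      coloured r n T (fun j => B (Equiv.swap i (i + 1) j)) := by
  obtain ⟨τ, hτ, hττ⟩ := exists_swap_fin h1 hr
  refine diagram_mul_eq (Sum.elim (fun a : Fin r => T (a + 1))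
    (Sum.elim (fun a : Fin r => Sum.inl (B (a + 1)))
      fun a : Fin r => Sum.inl (B (Equiv.swap i (i + 1) (a + 1))))) ?_ ?_ ?_ ?_ ?_
  · rintro (a | a) (b | b) h <;> exact h
  · rintro (a | a) (b | b) h <;> rw [Setoid.ker_def] at h <;>
      simp only [Sum.elim_inl, Sum.elim_inr, EmbeddingLike.apply_eq_iff_eq] at h <;>
      simp only [lower, Sum.elim_inl, Sum.elim_inr]
    · rw [h]
    · rw [← h, Equiv.swap_apply_self]
    · rw [h, Equiv.swap_apply_self]
    · rw [h]
  · rintro (a | a) (b | b) h <;> exact h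
  · have key : ∀ v : Vertex r, stack (Setoid.ker (Sum.elim (fun i : Fin r => T (i + 1))
          (fun i : Fin r => Sum.inl (B (i + 1)))))
        (colourDiagram r (fun j => Equiv.swap i (i + 1) j) fun j => j)
        (outer v) (upper (Sum.map _root_.id τ v)) := by
      rintro (a | a)
      · exact Setoid.refl' _ _
      · refine stack_lower (v := Sum.inr a) (v' := Sum.inl (τ a)) ?_
        rw [Setoid.ker_def]
        simp [hτ]
    intro v w h
    refine Setoid.trans' _ (key v) (Setoid.trans' _ (stack_upper ?_) (Setoid.symm' _ (key w)))
    rw [Setoid.ker_def] at h ⊢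
    rcases v with a | a <;> rcases w with b | b <;> simpa [hτ] using h
  · intro a
    refine ⟨Sum.inr (τ a), stack_lower (v := Sum.inr (τ a)) (v' := Sum.inl a) ?_⟩
    rw [Setoid.ker_def]
    simp [hτ]

/-- Multiplication by `p_i` isolates the northern vertex `i`. No middle component is removed if
this vertex was connected to a southern vertex. -/
lemma pGen_mul_coloured {i : ℕ} {T : ℕ → ℕ ⊕ ℕ} {B : ℕ → ℕ}
    (hB : ∃ j, 1 ≤ j ∧ j ≤ r ∧ T i = Sum.inl (B j)) (hT : ∀ j, j ≠ i → T j ≠ Sum.inr i) :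
    pGen r n i * coloured r n T B =
      coloured r n (fun j => if j = i then Sum.inr i else T j) B := by
  refine diagram_mul_eq (Sum.elim
    (fun a : Fin r => if (a : ℕ) + 1 = i then Sum.inr i else T (a + 1))
    (Sum.elim (fun a : Fin r => T (a + 1)) fun a : Fin r => Sum.inl (B (a + 1)))) ?_ ?_ ?_ ?_ ?_
  · rintro (a | a) (b | b) h <;> rw [Setoid.ker_def] at h <;>
      simp only [Sum.elim_inl, Sum.elim_inr] at h <;> simp only [upper, Sum.elim_inl, Sum.elim_inr,
        Function.comp_apply]
    · simp [h]
    · split_ifs at h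
      rw [if_neg (by omega), h]
    · split_ifs at h
      rw [if_neg (by omega), h]
    · split_ifs at h
      · congr 2; omega
      · rw [h]
  · rintro (a | a) (b | b) h <;> exact h
  · rintro (a | a) (b | b) h <;> exact h
  · have key : ∀ v : Vertex r, (∀ a : Fin r, v = Sum.inl a → (a : ℕ) + 1 ≠ i) →
        stack (colourDiagram r (fun j => j) (fun j => if j = i then 0 else j))
        (Setoid.ker (Sum.elim (fun i : Fin r => T (i + 1))
          (fun i : Fin r => Sum.inl (B (i + 1))))) (outer v) (lower v) := by
      rintro (a | a) ha
      · refine stack_upper (v := Sum.inl a) (v' := Sum.inr a) ?_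
        rw [Setoid.ker_def]
        simp [ha a rfl]
      · exact Setoid.refl' _ _
    intro v w h
    rw [Setoid.ker_def] at h
    by_cases hv : ∃ a : Fin r, v = Sum.inl a ∧ (a : ℕ) + 1 = i
    · obtain ⟨a, rfl, ha⟩ := hv
      rcases w with b | b
      · by_cases hb : (b : ℕ) + 1 = i
        · obtain rfl : a = b := Fin.ext (by omega)
          exact Setoid.refl' _ _
        · simp only [Sum.elim_inl, if_pos ha, if_neg hb] at h
          exact absurd h.symm (hT _ hb)
      · simp [ha] at h
    · push Not at hv
      by_cases hw : ∃ a : Fin r, w = Sum.inl a ∧ (a : ℕ) + 1 = i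
      · obtain ⟨b, rfl, hb⟩ := hw
        rcases v with a | a
        · simp only [Sum.elim_inl, if_pos hb, if_neg (hv a rfl)] at h
          exact absurd h (hT _ (hv a rfl))
        · simp [hb] at h
      · push Not at hw
        refine Setoid.trans' _ (key v hv) (Setoid.trans' _ (stack_lower ?_)
          (Setoid.symm' _ (key w hw)))
        rw [Setoid.ker_def]
        rcases v with a | a <;> rcases w with b | b <;>
          simp_all
  · intro a
    by_cases ha : (a : ℕ) + 1 = i
    · obtain ⟨j, hj1, hj2, hj⟩ := hB
      refine ⟨Sum.inr ⟨j - 1, by omega⟩,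
        stack_lower (v := Sum.inr ⟨j - 1, by omega⟩) (v' := Sum.inl a) ?_⟩
      rw [Setoid.ker_def]
      simp [ha, hj, Nat.sub_add_cancel hj1]
    · refine ⟨Sum.inl a, stack_upper (v := Sum.inl a) (v' := Sum.inr a) ?_⟩
      rw [Setoid.ker_def]
      simp [ha]

/-- Multiplication by `p_{i+1/2}` identifies the colours of the northern vertices `i` and
`i + 1`. These are `x` and `y`, in any order, and `x` is replaced by `y`. -/
lemma pHalfGen_mul_coloured {i : ℕ} (h1 : 1 ≤ i) (hr : i < r) {T T' : ℕ → ℕ ⊕ ℕ} {B B' : ℕ → ℕ}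
    {x y : ℕ ⊕ ℕ} (hxy : (T i = x ∧ T (i + 1) = y) ∨ (T i = y ∧ T (i + 1) = x))
    (hT : ∀ j, 1 ≤ j → j ≤ r → T' j = if T j = x then y else T j)
    (hB : ∀ j, 1 ≤ j → j ≤ r →
      (Sum.inl (B' j) : ℕ ⊕ ℕ) = if Sum.inl (B j) = x then y else Sum.inl (B j)) :
    pHalfGen r n i * coloured r n T B = coloured r n T' B' := by
  set φ : ℕ ⊕ ℕ → ℕ ⊕ ℕ := fun z => if z = x then y else z with hφ
  have hφ' : ∀ z z', φ z = φ z' → z = z' ∨ (z = T i ∧ z' = T (i + 1)) ∨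
      (z = T (i + 1) ∧ z' = T i) := by
    intro z z' h
    simp only [hφ] at h
    split_ifs at h with e1 e2 e2
    · exact Or.inl (e1.trans e2.symm)
    · rcases hxy with ⟨e3, e4⟩ | ⟨e3, e4⟩ <;> simp [e1, e3, e4, h]
    · rcases hxy with ⟨e3, e4⟩ | ⟨e3, e4⟩ <;> simp [e2, e3, e4, h]
    · exact Or.inl h
  have hφi : φ (T i) = φ (T (i + 1)) := by
    simp only [hφ]
    rcases hxy with ⟨e3, e4⟩ | ⟨e3, e4⟩ <;> rw [e3, e4] <;> simp
  set g : Vertex r → ℕ ⊕ ℕ :=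
    Sum.elim (fun i : Fin r => T (i + 1)) (fun i : Fin r => Sum.inl (B (i + 1))) with hg
  have hg' : ∀ v, Sum.elim (fun i : Fin r => T' (i + 1)) (fun i : Fin r => Sum.inl (B' (i + 1))) v
      = φ (g v) := by
    rintro (a | a)
    · exact hT _ (by omega) (by omega)
    · exact hB _ (by omega) (by omega)
  have hcol : ∀ a b : Fin r, (if (a : ℕ) + 1 = i + 1 then i else (a : ℕ) + 1) =
      (if (b : ℕ) + 1 = i + 1 then i else (b : ℕ) + 1) → φ (T (a + 1)) = φ (T (b + 1)) := by
    intro a b h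
    split_ifs at h with e1 e2 e2
    · rw [e1, e2]
    · rw [e1, ← h, hφi]
    · rw [e2, h, hφi]
    · rw [h]
  refine diagram_mul_eq (Sum.elim (fun a : Fin r => φ (T (a + 1)))
    (Sum.elim (fun a : Fin r => φ (T (a + 1))) fun a : Fin r => φ (Sum.inl (B (a + 1)))))
    ?_ ?_ ?_ ?_ ?_
  · rintro (a | a) (b | b) h <;> exact hcol a b h
  · rintro (a | a) (b | b) h <;> exact congrArg φ h
  · intro v w h
    rw [Setoid.ker_def, hg', hg']
    rcases v with a | a <;> rcases w with b | b <;> exact h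
  · have key : ∀ v : Vertex r,
        stack (colourDiagram r (fun j => if j = i + 1 then i else j)
          (fun j => if j = i + 1 then i else j)) (Setoid.ker g) (outer v) (lower v) := by
      rintro (a | a)
      · exact stack_upper (v := Sum.inl a) (v' := Sum.inr a) rfl
      · exact Setoid.refl' _ _
    let a : Fin r := ⟨i - 1, by omega⟩
    let b : Fin r := ⟨i, hr⟩
    have ha : g (Sum.inl a) = T i := by
      change T (i - 1 + 1) = _
      rw [Nat.sub_add_cancel h1]
    have hb : g (Sum.inl b) = T (i + 1) := rfl
    have hab : stack (colourDiagram r (fun j => if j = i + 1 then i else j)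
          (fun j => if j = i + 1 then i else j)) (Setoid.ker g)
          (lower (Sum.inl a)) (lower (Sum.inl b)) := by
      refine stack_upper (v := Sum.inr a) (v' := Sum.inr b) ?_
      rw [Setoid.ker_def]
      simp only [a, b, Sum.elim_inr, if_true]
      rw [if_neg (by omega)]
      omega
    intro v w h
    rw [Setoid.ker_def, hg', hg'] at h
    refine Setoid.trans' _ (key v) (Setoid.trans' _ ?_ (Setoid.symm' _ (key w)))
    rcases hφ' _ _ h with h | ⟨hv, hw⟩ | ⟨hv, hw⟩
    · exact stack_lower h
    · exact Setoid.trans' _ (stack_lower (hv.trans ha.symm))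
        (Setoid.trans' _ hab (stack_lower (hb.trans hw.symm)))
    · exact Setoid.trans' _ (stack_lower (hv.trans hb.symm))
        (Setoid.trans' _ (Setoid.symm' _ hab) (stack_lower (ha.trans hw.symm)))
  · intro a
    exact ⟨Sum.inl a, stack_upper (v := Sum.inl a) (v' := Sum.inr a) rfl⟩

/-! ### The products `e_k^{(l)}` and `e_{k+1/2}^{(l)}` on coloured diagrams -/

lemma eInt_succ {k l : ℕ} (h : l < k) :
    eInt r n k (l + 1) = pGen r n (k - l) * eInt r n k l := by
  rw [eInt, eInt, List.range_succ_eq_map, List.map_cons, List.prod_cons, List.map_map]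
  congr 2
  · omega
  · apply List.map_congr_left
    intro i _
    simp only [Function.comp_apply]
    congr 1
    omega

lemma eHalf_succ {k l : ℕ} (h : l < k) :
    eHalf r n k (l + 1) = pHalfGen r n (k - l) * eHalf r n k l := by
  rw [eHalf, eHalf, List.range_succ_eq_map, List.map_cons, List.prod_cons, List.map_map]
  congr 2
  · omega
  · apply List.map_congr_left
    intro i _
    simp only [Function.comp_apply]
    congr 1
    omega

/-- Multiplication by `e_k^{(l)}` isolates the northern vertices `k - l + 1, …, k`. -/
lemma eInt_mul_coloured {k l : ℕ} (hl : l ≤ k) {T : ℕ → ℕ ⊕ ℕ} {B : ℕ → ℕ}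
    (hB : ∀ i, k - l < i → i ≤ k → ∃ j, 1 ≤ j ∧ j ≤ r ∧ T i = Sum.inl (B j))
    (hT : ∀ i j, T i = Sum.inr j → i = j) :
    eInt r n k l * coloured r n T B =
      coloured r n (fun j => if k - l < j ∧ j ≤ k then Sum.inr j else T j) B := by
  induction l with
  | zero =>
    rw [eInt, List.range_zero, List.map_nil, List.prod_nil, one_mul]
    apply coloured_congr
    · intro j _ _
      rw [if_neg (by omega)]
    · exact fun _ _ _ => rfl
  | succ l ih =>
    rw [eInt_succ (by omega), mul_assoc, ih (by omega) fun i h1 h2 => hB i (by omega) h2,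
      pGen_mul_coloured]
    · apply coloured_congr
      · intro j _ _
        by_cases e : j = k - l
        · rw [if_pos e, if_pos (by omega), e]
        · rw [if_neg e]
          split_ifs <;> first | rfl | omega
      · exact fun _ _ _ => rfl
    · rw [if_neg (by omega)]
      exact hB _ (by omega) (by omega)
    · intro j hj h
      split_ifs at h
      · exact hj (Sum.inr.inj h)
      · exact hj (hT _ _ h)

/-- Multiplication by `e_{k+1/2}^{(l)}` connects the isolated northern vertices
`k - l + 1, …, k` to the northern vertex `k + 1`. -/
lemma eHalf_mul_coloured {k l : ℕ} (hl : l ≤ k) (hr : k < r) {T : ℕ → ℕ ⊕ ℕ} {B : ℕ → ℕ}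
    (hB : ∀ i, k - l < i → i ≤ k → T i = Sum.inr i)
    (hT : ∀ i j, T i = Sum.inr j → i = j) :
    eHalf r n k l * coloured r n T B =
      coloured r n (fun j => if k - l < j ∧ j ≤ k then T (k + 1) else T j) B := by
  induction l with
  | zero =>
    rw [eHalf, List.range_zero, List.map_nil, List.prod_nil, one_mul]
    apply coloured_congr
    · intro j _ _
      rw [if_neg (by omega)]
    · exact fun _ _ _ => rfl
  | succ l ih =>
    rw [eHalf_succ (by omega), mul_assoc, ih (by omega) fun i h1 h2 => hB i (by omega) h2]
    have hi := hB (k - l) (by omega) (by omega)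
    have hne : ∀ j, j ≠ k - l → T j ≠ Sum.inr (k - l) := fun j hj h => hj (hT _ _ h)
    refine pHalfGen_mul_coloured (x := Sum.inr (k - l)) (y := T (k + 1)) (by omega) (by omega)
      (Or.inl ⟨?_, ?_⟩) ?_ ?_
    · rw [if_neg (by omega), hi]
    · split_ifs with e
      · rfl
      · congr 1
        omega
    · intro j _ _
      by_cases e : j = k - l
      · rw [if_pos (by omega), if_neg (by omega : ¬ (k - l < j ∧ j ≤ k)), if_pos (by rw [e, hi])]
      · by_cases e' : k - l < j ∧ j ≤ k
        · rw [if_pos (by omega), if_pos e', if_neg (hne _ (by omega))]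
        · rw [if_neg (by omega), if_neg e', if_neg (hne _ e)]
    · intro j _ _
      rw [if_neg (by simp)]

/-! ### Words of colours on the northern vertices -/

/-- The colouring of the northern vertices `1, …, |w|` by the entries of `w`, and of the others
by `d`. -/
def wordTop (w : List ℕ) (d : ℕ → ℕ ⊕ ℕ) (j : ℕ) : ℕ ⊕ ℕ := (w[j - 1]?).elim (d j) Sum.inl

lemma wordTop_of_lt {w : List ℕ} {d : ℕ → ℕ ⊕ ℕ} {j : ℕ} (h : w.length < j) :
    wordTop w d j = d j := by
  rw [wordTop, List.getElem?_eq_none (by omega)]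
  rfl

lemma wordTop_of_le {w : List ℕ} {d : ℕ → ℕ ⊕ ℕ} {j : ℕ} (h1 : 1 ≤ j) (h : j ≤ w.length) :
    wordTop w d j = Sum.inl (w[j - 1]'(by omega)) := by
  rw [wordTop, List.getElem?_eq_getElem (by omega)]
  rfl

lemma sGen_mul_wordTop {P S : List ℕ} {a b : ℕ} {d : ℕ → ℕ ⊕ ℕ} {B : ℕ → ℕ}
    (h : P.length + 1 < r) :
    sGen r n (P.length + 1) * coloured r n (wordTop (P ++ a :: b :: S) d) B =
      coloured r n (wordTop (P ++ b :: a :: S) d) B := by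
  rw [sGen_mul_coloured (by omega) h]
  apply coloured_congr
  · intro j hj1 _
    by_cases e1 : j = P.length + 1
    · subst e1
      rw [Equiv.swap_apply_left]
      simp [wordTop]
    by_cases e2 : j = P.length + 1 + 1
    · subst e2
      rw [Equiv.swap_apply_right]
      simp [wordTop]
    rw [Equiv.swap_apply_of_ne_of_ne e1 e2]
    rw [wordTop, wordTop, List.getElem?_append, List.getElem?_append]
    split_ifs with h'
    · rfl
    · obtain ⟨m, rfl⟩ : ∃ m, j = P.length + 1 + 1 + 1 + m := ⟨j - (P.length + 3), by omega⟩
      have : P.length + 1 + 1 + 1 + m - 1 - P.length = m + 1 + 1 := by omega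
      rw [this]
      rfl
  · exact fun _ _ _ => rfl

lemma sTrans_succ {l k : ℕ} (h1 : 1 ≤ l) (h : l ≤ k) :
    sTrans r n l (k + 1) = sTrans r n l k * sGen r n k := by
  rw [sTrans, sTrans, if_neg (by omega : ¬ (l = 0 ∨ k + 1 = 0)),
    if_neg (by omega : ¬ (l = 0 ∨ k = 0)), if_pos (by omega : l ≤ k + 1), if_pos h,
    Nat.succ_sub h, List.range_succ]
  simp only [List.map_append, List.prod_append, List.map_cons, List.map_nil, List.prod_cons,
    List.prod_nil, mul_one]
  rw [Nat.add_sub_cancel' h]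

/-- `s_{l,k}` with `l ≤ k` moves the `k`-th letter to the position `l`. -/
lemma sTrans_mul_wordTop {P M S : List ℕ} {c : ℕ} {d : ℕ → ℕ ⊕ ℕ} {B : ℕ → ℕ}
    (h : P.length + M.length + 1 ≤ r) :
    sTrans r n (P.length + 1) (P.length + M.length + 1) *
        coloured r n (wordTop (P ++ M ++ c :: S) d) B =
      coloured r n (wordTop (P ++ c :: (M ++ S)) d) B := by
  induction M using List.reverseRecOn generalizing S with
  | nil => simp [sTrans]
  | append_singleton M m ih =>
    rw [List.length_append, List.length_singleton, ← add_assoc] at h ⊢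
    rw [sTrans_succ (by omega) (by omega), mul_assoc]
    have := sGen_mul_wordTop (r := r) (n := n) (P := P ++ M) (S := S) (a := m) (b := c) (d := d)
      (B := B) (by rw [List.length_append]; omega)
    rw [List.length_append] at this
    rw [show P ++ (M ++ [m]) ++ c :: S = P ++ M ++ m :: c :: S by simp, this, ih (by omega)]
    simp

/-- `s_{k,l}` with `l ≤ k` moves the `l`-th letter to the position `k`. -/
lemma sTrans_mul_wordTop' {P M S : List ℕ} {c : ℕ} {d : ℕ → ℕ ⊕ ℕ} {B : ℕ → ℕ}
    (h : P.length + M.length + 1 ≤ r) :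
    sTrans r n (P.length + M.length + 1) (P.length + 1) *
        coloured r n (wordTop (P ++ c :: (M ++ S)) d) B =
      coloured r n (wordTop (P ++ M ++ c :: S) d) B := by
  rw [← sTrans_mul_wordTop h, ← mul_assoc, sTrans_mul_sTrans h (by omega), one_mul]

/-- The diagram of level `k` described by a word `w` of colours and a colouring `B` of the southern
vertices: the northern vertex `j ≤ |w|` is connected to the southern block of colour `w_j`, the
northern vertices `|w| < j ≤ k` are isolated, and those with `j > k` are connected to the block
of the southern vertex `j`. -/
def state (r n k : ℕ) (w : List ℕ) (B : ℕ → ℕ) : PartitionAlgebra r n :=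
  coloured r n (wordTop w fun j => if j ≤ k then Sum.inr j else Sum.inl (B j)) B

/-- The diagram of level `k + 1/2` described by `w`, `c` and `B`: it differs from the one of level
`k + 1` in that the northern vertices `|w| < j ≤ k + 1` are connected to the block of
colour `c`. -/
def halfState (r n k : ℕ) (w : List ℕ) (c : ℕ) (B : ℕ → ℕ) : PartitionAlgebra r n :=
  coloured r n (wordTop w fun j => if j ≤ k + 1 then Sum.inl c else Sum.inl (B j)) B

/-- Appending `c` to the word is a change of notation: the northern vertex `|w| + 1` has the
colour `c` anyway. -/
lemma halfState_append {k c : ℕ} {w : List ℕ} {B : ℕ → ℕ} (h : w.length ≤ k) :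
    halfState r n k (w ++ [c]) c B = halfState r n k w c B := by
  apply coloured_congr
  · intro j h1 _
    by_cases e : j ≤ w.length
    · rw [wordTop_of_le h1 (by simp; omega), wordTop_of_le h1 e, List.getElem_append_left]
    · rw [wordTop_of_lt (w := w) (by omega)]
      by_cases e' : j = w.length + 1
      · subst e'
        rw [if_pos (by omega), wordTop_of_le h1 (by simp)]
        simp
      · rw [wordTop_of_lt (by simp; omega)]
  · exact fun _ _ _ => rfl

/-- The northern vertices beyond the word are isolated. They are connected to the southern vertex
`k + 1` beforehand, so that no middle component is removed. -/
lemma eInt_mul_halfState {k c : ℕ} {w : List ℕ} {B : ℕ → ℕ} (hw : w.length ≤ k + 1) (hr : k < r)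
    (hc : c = B (k + 1)) :
    eInt r n (k + 1) (k + 1 - w.length) * halfState r n k w c B = state r n (k + 1) w B := by
  rw [halfState, eInt_mul_coloured (by omega)]
  · apply coloured_congr
    · intro j h1 _
      by_cases e : j ≤ w.length
      · rw [if_neg (by omega), wordTop_of_le h1 e, wordTop_of_le h1 e]
      · rw [wordTop_of_lt (by omega), wordTop_of_lt (by omega)]
        by_cases e' : j ≤ k + 1
        · rw [if_pos (by omega), if_pos e']
        · rw [if_neg (by omega), if_neg e', if_neg e']
    · exact fun _ _ _ => rfl
  · intro i h1 h2
    refine ⟨k + 1, by omega, by omega, ?_⟩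
    rw [wordTop_of_lt (by omega), if_pos h2, hc]
  · intro i j h
    rw [wordTop] at h
    rcases e : w[i - 1]? with _ | c' <;> rw [e] at h <;> simp only [Option.elim] at h
    · split_ifs at h
    · cases h

lemma wordTop_state_eq_inr {w : List ℕ} {k i j : ℕ} {B : ℕ → ℕ}
    (h : wordTop w (fun j => if j ≤ k then Sum.inr j else Sum.inl (B j)) i = Sum.inr j) :
    i = j := by
  rw [wordTop] at h
  rcases e : w[i - 1]? with _ | c <;> rw [e] at h <;> simp only [Option.elim] at h
  · split_ifs at h
    exact Sum.inr.inj h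
  · cases h

/-- The vertex `k + 1` starts a new block. -/
lemma eHalf_mul_state {k : ℕ} {w : List ℕ} {B : ℕ → ℕ} (hw : w.length ≤ k) (hr : k < r)
    (hB : ∀ j, k < j → B j = j) :
    eHalf r n k (k - w.length) * state r n k w B =
      halfState r n k w (k + 1) (Function.update B (k + 1) (k + 1)) := by
  have hB' : Function.update B (k + 1) (k + 1) = B := by
    rw [Function.update_eq_self_iff, hB _ (by omega)]
  rw [hB', state, eHalf_mul_coloured (by omega) hr]
  · apply coloured_congr
    · intro j h1 _
      rw [wordTop_of_lt (j := k + 1) (by omega), if_neg (by omega : ¬ (k + 1 ≤ k)),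
        hB (k + 1) (by omega)]
      by_cases e : j ≤ w.length
      · rw [if_neg (by omega), wordTop_of_le h1 e, wordTop_of_le h1 e]
      · rw [wordTop_of_lt (by omega), wordTop_of_lt (by omega)]
        by_cases e' : j ≤ k
        · rw [if_pos (by omega), if_pos (by omega)]
        · rw [if_neg (by omega), if_neg e', hB _ (by omega)]
          split_ifs
          · congr 1; omega
          · rfl
    · exact fun _ _ _ => rfl
  · intro i h1 h2
    rw [wordTop_of_lt (by omega), if_pos h2]
  · exact fun i j h => wordTop_state_eq_inr h

/-- The vertex `k + 1` joins the block of the last letter of the word. -/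
lemma eHalf_mul_state_append {k c : ℕ} {w : List ℕ} {B : ℕ → ℕ} (hw : w.length < k) (hr : k < r)
    (hB : ∀ j, k < j → B j = j) (hB' : ∀ j, j ≤ k → B j ≤ k) (hwc : ∀ x ∈ w, x ≤ k) (hc : c ≤ k) :
    eHalf r n k (k - w.length) * state r n k (w ++ [c]) B =
      halfState r n k w c (Function.update B (k + 1) c) := by
  have hl : k - w.length = (k - (w.length + 1)) + 1 := by omega
  have hlen : (w ++ [c]).length = w.length + 1 := by simp
  rw [hl, eHalf_succ (by omega), mul_assoc, state, eHalf_mul_coloured (by omega) hr]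
  · have e1 : k - (k - (w.length + 1)) = w.length + 1 := by omega
    rw [e1]
    refine pHalfGen_mul_coloured (x := Sum.inl (k + 1)) (y := Sum.inl c) (by omega) (by omega)
      (Or.inr ⟨?_, ?_⟩) ?_ ?_
    · rw [if_neg (by omega), wordTop_of_le (by omega) (by omega)]
      simp
    · rw [wordTop_of_lt (j := k + 1) (by omega), if_neg (by omega : ¬ (k + 1 ≤ k)),
        hB (k + 1) (by omega)]
      split_ifs
      · rfl
      · rw [show w.length + 1 + 1 = k + 1 by omega, wordTop_of_lt (j := k + 1) (by omega),
          if_neg (by omega : ¬ (k + 1 ≤ k)), hB (k + 1) (by omega)]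
    · intro j h1 _
      rw [wordTop_of_lt (j := k + 1) (by omega), if_neg (by omega : ¬ (k + 1 ≤ k)),
        hB (k + 1) (by omega)]
      by_cases e : j ≤ w.length
      · have : w[j - 1] ≤ k := hwc _ (List.getElem_mem _)
        rw [if_neg (by omega : ¬ (w.length + 1 < j ∧ j ≤ k)),
          wordTop_of_le (w := w ++ [c]) h1 (by omega),
          wordTop_of_le h1 e, List.getElem_append_left, if_neg]
        intro h
        have := Sum.inl.inj h
        omega
      · rw [wordTop_of_lt (w := w) (by omega)]
        by_cases e' : j = w.length + 1
        · rw [if_neg (by omega : ¬ (w.length + 1 < j ∧ j ≤ k)), wordTop_of_le h1 (by omega),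
            if_pos (by omega)]
          subst e'
          rw [if_neg]
          · simp
          · intro h
            have := Sum.inl.inj h
            simp at this
            omega
        · rw [wordTop_of_lt (j := j) (by omega)]
          by_cases e2 : j ≤ k
          · rw [if_pos (by omega : j ≤ k + 1),
              if_pos (⟨by omega, e2⟩ : w.length + 1 < j ∧ j ≤ k), if_pos rfl]
          · rw [if_neg (by omega : ¬ (w.length + 1 < j ∧ j ≤ k)), if_neg e2, hB j (by omega)]
            by_cases e3 : j = k + 1
            · rw [if_pos (by omega), if_pos (by rw [e3])]
            · rw [if_neg (by omega), Function.update_of_ne e3, hB j (by omega), if_neg]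
              intro h
              exact e3 (Sum.inl.inj h)
    · intro j _ _
      by_cases e3 : j = k + 1
      · subst e3
        rw [Function.update_self, hB _ (by omega), if_pos rfl]
      · rw [Function.update_of_ne e3, if_neg]
        intro h
        have h := Sum.inl.inj h
        rcases le_or_gt j k with e | e
        · have := hB' j e
          omega
        · rw [hB j e] at h
          exact e3 h
  · intro i h1 h2
    rw [wordTop_of_lt (by omega), if_pos h2]
  · exact fun i j h => wordTop_state_eq_inr h

/-! ### Row lengths of Young diagrams -/

lemma rowLen_eq_zero_of_card_le {μ : YoungDiagram} {i : ℕ} (h : μ.card ≤ i) :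
    μ.rowLen i = 0 := by
  by_contra h0
  have hmem : ∀ j ∈ Finset.range (i + 1), (j, 0) ∈ μ.cells := by
    intro j hj
    have hi : (i, 0) ∈ μ := YoungDiagram.mem_iff_lt_rowLen.2 (Nat.pos_of_ne_zero h0)
    exact μ.up_left_mem (by rw [Finset.mem_range] at hj; omega) le_rfl hi
  have := Finset.card_le_card_of_injOn (fun j => (j, 0)) hmem (fun a _ b _ e => by simpa using e)
  rw [Finset.card_range] at this
  change i + 1 ≤ μ.card at this
  omega

lemma card_eq_rowSum {μ : YoungDiagram} {N : ℕ} (h : μ.card ≤ N) : μ.card = rowSum μ N := by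
  have hmap : ∀ c ∈ μ.cells, c.1 ∈ Finset.range N := by
    intro c hc
    rw [Finset.mem_range]
    by_contra hN
    have h0 := rowLen_eq_zero_of_card_le (μ := μ) (i := c.1) (by omega)
    have : c.2 < μ.rowLen c.1 := YoungDiagram.mem_iff_lt_rowLen.1 hc
    omega
  rw [YoungDiagram.card, Finset.card_eq_sum_card_fiberwise hmap, rowSum]
  apply Finset.sum_congr rfl
  intro i _
  rw [YoungDiagram.rowLen_eq_card]
  rfl

lemma rowSum_succ (μ : YoungDiagram) (a : ℕ) : rowSum μ (a + 1) = rowSum μ a + μ.rowLen a :=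
  Finset.sum_range_succ _ _

lemma IsAddStep.label_unique {μ ρ : YoungDiagram} {a b : ℕ} (h : IsAddStep a μ ρ)
    (h' : IsAddStep b μ ρ) : a = b := by
  by_contra hab
  rcases Nat.eq_zero_or_pos a with rfl | ha
  · have h1 := h (b - 1)
    have h2 := h' (b - 1)
    rw [if_neg (by omega)] at h1
    rw [if_pos (by omega)] at h2
    omega
  · have h1 := h (a - 1)
    have h2 := h' (a - 1)
    rw [if_pos (by omega)] at h1
    rw [if_neg (by omega)] at h2
    omega

/-! ### Rows of colours -/

lemma insertIdx_append_length (L L' : List ℕ) (c : ℕ) :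
    (L ++ L').insertIdx L.length c = L ++ c :: L' := by
  induction L with
  | nil => rfl
  | cons a L ih => simp [List.insertIdx_succ_cons, ih]

/-- The word with rows `R 0, …, R (N - 1)`. Rows are stored from right to left: the last letter of
a row of the word is the head of the list. -/
def rowWord (N : ℕ) (R : ℕ → List ℕ) : List ℕ := (List.range N).flatMap fun i => (R i).reverse

lemma rowWord_succ (N : ℕ) (R : ℕ → List ℕ) :
    rowWord (N + 1) R = rowWord N R ++ (R N).reverse := by
  simp [rowWord, List.range_succ]

lemma rowWord_congr {N : ℕ} {R R' : ℕ → List ℕ} (h : ∀ i, i < N → R i = R' i) :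
    rowWord N R = rowWord N R' := by
  induction N with
  | zero => rfl
  | succ N ih => rw [rowWord_succ, rowWord_succ, ih fun i hi => h i (by omega), h N (by omega)]

lemma length_rowWord (N : ℕ) (R : ℕ → List ℕ) :
    (rowWord N R).length = ∑ i ∈ Finset.range N, (R i).length := by
  induction N with
  | zero => rfl
  | succ N ih => rw [rowWord_succ, List.length_append, ih, Finset.sum_range_succ,
      List.length_reverse]

lemma mem_rowWord {N c : ℕ} {R : ℕ → List ℕ} : c ∈ rowWord N R ↔ ∃ i, i < N ∧ c ∈ R i := by
  simp [rowWord]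

lemma exists_rowWord_update {N q : ℕ} (hq : q < N) (R : ℕ → List ℕ) :
    ∃ S, ∀ L, rowWord N (Function.update R q L) = rowWord q R ++ L.reverse ++ S := by
  obtain ⟨m, rfl⟩ := Nat.exists_eq_add_of_lt hq
  induction m with
  | zero =>
    refine ⟨[], fun L => ?_⟩
    rw [add_zero, rowWord_succ, Function.update_self, List.append_nil,
      rowWord_congr (R := Function.update R q L) (R' := R) fun i hi =>
        Function.update_of_ne (by omega) _ _]
  | succ m ih =>
    obtain ⟨S, hS⟩ := ih (by omega)
    refine ⟨S ++ (R (q + m + 1)).reverse, fun L => ?_⟩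
    have : q + (m + 1) + 1 = (q + m + 1) + 1 := by omega
    rw [this, rowWord_succ, hS, Function.update_of_ne (by omega)]
    simp

/-- The removal of the last letter of row `a` (numbered from `1`): the letter and the remaining
rows. For `a = 0` nothing is removed, and the letter is `d`. The value for an empty row is
irrelevant. -/
def popRow (a d : ℕ) (R : ℕ → List ℕ) : ℕ × (ℕ → List ℕ) :=
  if a = 0 then (d, R) else ((R (a - 1)).headD 0, Function.update R (a - 1) (R (a - 1)).tail)

/-- The insertion of the letter `c` into row `b` (numbered from `1`), followed by `i` letters of the
row. For `b = 0` nothing happens. -/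
def insRow (b c i : ℕ) (R : ℕ → List ℕ) : ℕ → List ℕ :=
  if b = 0 then R else Function.update R (b - 1) ((R (b - 1)).insertIdx i c)

/-- The number of places at which a letter can be inserted to row `b`, read as `1` for `b = 0`. -/
def insCount (b : ℕ) (R : ℕ → List ℕ) : ℕ := if b = 0 then 1 else (R (b - 1)).length + 1

/-- `R` is a filling of the shape `lam` by colours of the southern blocks of level `k`, which are
described by `B`: the southern vertices up to `k` have colours up to `k`, and the vertices `j > k`
have the colour `j`. -/
structure IsFilling (k : ℕ) (lam : YoungDiagram) (R : ℕ → List ℕ) (B : ℕ → ℕ) : Prop where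
  length_eq : ∀ i, (R i).length = lam.rowLen i
  exists_eq : ∀ i, ∀ c ∈ R i, ∃ j, j ≤ k ∧ B j = c
  le_of_le : ∀ j, j ≤ k → B j ≤ k
  eq_of_lt : ∀ j, k < j → B j = j

lemma IsFilling.le {k : ℕ} {lam : YoungDiagram} {R : ℕ → List ℕ} {B : ℕ → ℕ}
    (h : IsFilling k lam R B) {i c : ℕ} (hc : c ∈ R i) : c ≤ k := by
  obtain ⟨j, hj, rfl⟩ := h.exists_eq i c hc
  exact h.le_of_le j hj

lemma IsFilling.length_rowWord {k : ℕ} {lam : YoungDiagram} {R : ℕ → List ℕ} {B : ℕ → ℕ}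
    (h : IsFilling k lam R B) (a : ℕ) : (rowWord a R).length = rowSum lam a := by
  rw [PartitionAlg.length_rowWord, rowSum]
  exact Finset.sum_congr rfl fun i _ => h.length_eq i

/-- The summand of `u_{𝔱(k+1/2) → 𝔱(k+1)} u_{𝔱(k) → 𝔱(k+1/2)}` which corresponds to the `i`-th
summand of the row symmetrizer. -/
def stepTerm (r n k : ℕ) (lam μ ρ : YoungDiagram) (a b i : ℕ) : PartitionAlgebra r n :=
  eInt r n (k + 1) (k + 1 - ρ.card) * sTrans r n (rowSum ρ b - i) (rowSum ρ b) *
    sTrans r n (rowSum ρ b) ρ.card * upSub r n k lam μ a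

lemma upAdd_mul_upSub (r n k : ℕ) (lam μ ρ : YoungDiagram) (a b : ℕ) :
    upAdd r n k ρ b * upSub r n k lam μ a =
      ∑ i ∈ Finset.range (if b = 0 then 1 else ρ.rowLen (b - 1)),
        stepTerm r n k lam μ ρ a b i := by
  by_cases hb : b = 0
  · subst hb
    simp [stepTerm, upAdd, rowSymmetrizer, rowSum, sTrans]
  · rw [if_neg hb, upAdd, rowSymmetrizer, if_neg hb]
    simp only [stepTerm, Finset.mul_sum, Finset.sum_mul]

lemma length_popRow {k : ℕ} {lam μ : YoungDiagram} {R : ℕ → List ℕ} {B : ℕ → ℕ} {a d : ℕ}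
    (hR : IsFilling k lam R B) (h : IsAddStep a μ lam) (i : ℕ) :
    ((popRow a d R).2 i).length = μ.rowLen i := by
  have hi := h i
  have hl := hR.length_eq i
  rw [popRow]
  split_ifs with ha
  · rw [hl, hi, if_neg (by omega), add_zero]
  · by_cases e : i = a - 1
    · subst e
      simp only [Function.update_self, List.length_tail]
      rw [if_pos (by omega)] at hi
      omega
    · simp only
      rw [Function.update_of_ne e]
      rw [if_neg (by omega)] at hi
      omega

/-- The coefficient of `-a` moves the last letter of row `a` to the end of the word and joins the
vertex `k + 1` to its block, or starts a new block if `a = 0`. -/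
lemma upSub_mul_state {k : ℕ} {lam μ : YoungDiagram} {R : ℕ → List ℕ} {B : ℕ → ℕ} {a : ℕ}
    (hR : IsFilling k lam R B) (h : IsAddStep a μ lam) (hk : k < r) (hc : lam.card ≤ k) :
    upSub r n k lam μ a * state r n k (rowWord r R) B =
      halfState r n k (rowWord r (popRow a (k + 1) R).2) (popRow a (k + 1) R).1
        (Function.update B (k + 1) (popRow a (k + 1) R).1) := by
  have hcard := h.card_eq
  have hμ : (rowWord r (popRow a (k + 1) R).2).length = μ.card := by
    rw [length_rowWord, card_eq_rowSum (N := r) (by omega), rowSum]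
    exact Finset.sum_congr rfl fun i _ => length_popRow hR h i
  rw [upSub, ← hμ]
  by_cases ha : a = 0
  · subst ha
    simp only [popRow, if_true] at hμ ⊢
    have : sTrans r n lam.card (rowSum lam 0) = 1 := by simp [sTrans, rowSum]
    rw [if_pos rfl] at hcard
    rw [this, mul_one, eHalf_mul_state (by omega) hk hR.eq_of_lt]
  · rw [if_neg ha] at hcard
    have hal : a - 1 < r := by
      by_contra hal
      have h1 := rowLen_eq_zero_of_card_le (μ := lam) (i := a - 1) (by omega)
      have h2 := h (a - 1)
      rw [if_pos (by omega)] at h2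
      omega
    obtain ⟨S, hS⟩ := exists_rowWord_update hal R
    have hlen := h (a - 1)
    rw [if_pos (by omega), ← hR.length_eq] at hlen
    obtain ⟨c, L, hcL⟩ : ∃ c L, R (a - 1) = c :: L :=
      List.exists_cons_of_length_pos (by omega)
    have hpop : popRow a (k + 1) R = (c, Function.update R (a - 1) L) := by
      rw [popRow, if_neg ha, hcL]
      rfl
    have hw : rowWord r R = rowWord (a - 1) R ++ L.reverse ++ c :: S := by
      have := hS (R (a - 1))
      rw [Function.update_eq_self] at this
      rw [this, hcL]
      simp
    rw [hpop] at hμ ⊢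
    simp only at hμ ⊢
    have hw' := hS L
    rw [hw'] at hμ ⊢
    have e1 : rowSum lam a = (rowWord (a - 1) R ++ L.reverse).length + 1 := by
      rw [List.length_append, hR.length_rowWord, List.length_reverse]
      obtain ⟨a, rfl⟩ : ∃ a', a = a' + 1 := ⟨a - 1, by omega⟩
      rw [rowSum_succ, ← hR.length_eq]
      simp only [Nat.add_sub_cancel] at hcL ⊢
      rw [hcL, List.length_cons]
      omega
    have e2 : lam.card = (rowWord (a - 1) R ++ L.reverse).length + S.length + 1 := by
      rw [List.length_append] at hμ
      omega
    have hmove := sTrans_mul_wordTop' (r := r) (n := n) (P := rowWord (a - 1) R ++ L.reverse)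
      (M := S) (S := []) (c := c)
      (d := fun j => if j ≤ k then Sum.inr j else Sum.inl (B j)) (B := B) (by omega)
    rw [List.append_nil] at hmove
    rw [e1, e2, mul_assoc, state, hw, hmove]
    refine eHalf_mul_state_append (by omega) hk hR.eq_of_lt hR.le_of_le ?_ ?_
    · intro x hx
      have hx' : x ∈ rowWord r R := by
        rw [hw]
        simp only [List.mem_append, List.mem_cons] at hx ⊢
        tauto
      obtain ⟨i, -, hi⟩ := mem_rowWord.1 hx'
      exact hR.le hi
    · exact hR.le (i := a - 1) (by rw [hcL]; exact List.mem_cons_self)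

lemma insCount_popRow {k : ℕ} {lam μ ρ : YoungDiagram} {R : ℕ → List ℕ} {B : ℕ → ℕ} {a b d : ℕ}
    (hR : IsFilling k lam R B) (h : IsAddStep a μ lam) (h' : IsAddStep b μ ρ) :
    insCount b (popRow a d R).2 = if b = 0 then 1 else ρ.rowLen (b - 1) := by
  rw [insCount, length_popRow hR h]
  split_ifs with hb
  · rfl
  · have := h' (b - 1)
    rw [if_pos (by omega)] at this
    omega

/-- A step of a path, applied to a state. -/
lemma stepTerm_mul_state {k : ℕ} {lam μ ρ : YoungDiagram} {R : ℕ → List ℕ} {B : ℕ → ℕ}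
    {a b i : ℕ} (hR : IsFilling k lam R B) (h : IsAddStep a μ lam) (h' : IsAddStep b μ ρ)
    (hk : k < r) (hc : lam.card ≤ k) (hi : i < insCount b (popRow a (k + 1) R).2) :
    stepTerm r n k lam μ ρ a b i * state r n k (rowWord r R) B =
      state r n (k + 1) (rowWord r (insRow b (popRow a (k + 1) R).1 i (popRow a (k + 1) R).2))
        (Function.update B (k + 1) (popRow a (k + 1) R).1) := by
  rw [stepTerm, mul_assoc, upSub_mul_state hR h hk hc]
  have hlen : ∀ i, ((popRow a (k + 1) R).2 i).length = μ.rowLen i := length_popRow hR h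
  generalize (popRow a (k + 1) R).1 = c at hlen hi ⊢
  generalize (popRow a (k + 1) R).2 = R1 at hlen hi ⊢
  have hcard := h.card_eq
  have hcard' := h'.card_eq
  have hμ : (rowWord r R1).length = μ.card := by
    rw [length_rowWord, card_eq_rowSum (N := r) (by omega), rowSum]
    exact Finset.sum_congr rfl fun i _ => hlen i
  by_cases hb : b = 0
  · subst hb
    rw [if_pos rfl, add_zero] at hcard'
    have h1 : ∀ x, sTrans r n (rowSum ρ 0) x = 1 := by simp [sTrans, rowSum]
    have h2 : ∀ x, sTrans r n x (rowSum ρ 0) = 1 := by simp [sTrans, rowSum]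
    rw [h1, h2, mul_one, mul_one, insRow, if_pos rfl, hcard', ← hμ,
      eInt_mul_halfState (by omega) hk (by rw [Function.update_self])]
  · rw [if_neg hb] at hcard'
    rw [insCount, if_neg hb] at hi
    have hbl : b - 1 < r := by
      by_contra hbl
      have h1 := rowLen_eq_zero_of_card_le (μ := ρ) (i := b - 1) (by omega)
      have h2 := h' (b - 1)
      rw [if_pos (by omega)] at h2
      omega
    obtain ⟨S, hS⟩ := exists_rowWord_update hbl R1
    have hw : rowWord r R1 = rowWord (b - 1) R1 ++ (R1 (b - 1)).reverse ++ S := by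
      have := hS (R1 (b - 1))
      rwa [Function.update_eq_self] at this
    set L1 := (R1 (b - 1)).take i with hL1
    set L2 := (R1 (b - 1)).drop i with hL2
    have hL : R1 (b - 1) = L1 ++ L2 := (List.take_append_drop _ _).symm
    have hlL1 : L1.length = i := by rw [hL1, List.length_take]; omega
    have hins : (R1 (b - 1)).insertIdx i c = L1 ++ c :: L2 := by
      rw [hL, ← hlL1, insertIdx_append_length]
    have e0 : (rowWord (b - 1) R1).length = rowSum ρ (b - 1) := by
      rw [length_rowWord, rowSum]
      refine Finset.sum_congr rfl fun j hj => ?_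
      rw [Finset.mem_range] at hj
      rw [hlen, h' j, if_neg (by omega), add_zero]
    have e1 : rowSum ρ b = (rowWord (b - 1) R1 ++ (R1 (b - 1)).reverse).length + 1 := by
      rw [List.length_append, e0, List.length_reverse, hlen]
      have := h' (b - 1)
      rw [if_pos (by omega)] at this
      obtain ⟨b, rfl⟩ : ∃ b', b = b' + 1 := ⟨b - 1, by omega⟩
      rw [rowSum_succ]
      simp only [Nat.add_sub_cancel] at this ⊢
      omega
    have e2 : ρ.card = (rowWord (b - 1) R1 ++ (R1 (b - 1)).reverse).length + S.length + 1 := by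
      rw [hw, List.length_append] at hμ
      omega
    have e3 : rowSum ρ b = (rowWord (b - 1) R1 ++ L2.reverse).length + L1.reverse.length + 1 := by
      rw [e1, hL]
      simp only [List.length_append, List.length_reverse]
      omega
    have hins' : rowWord r (insRow b c i R1) =
        rowWord (b - 1) R1 ++ L2.reverse ++ c :: (L1.reverse ++ S) := by
      rw [insRow, if_neg hb, hS, hins]
      simp
    have hlw : (rowWord r (insRow b c i R1)).length = ρ.card := by
      rw [hins', e2, hL]
      simp only [List.length_append, List.length_reverse, List.length_cons]
      omega
    rw [← halfState_append (by omega), hw, List.append_assoc _ S [c]]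
    have hm1 := sTrans_mul_wordTop (r := r) (n := n)
      (P := rowWord (b - 1) R1 ++ (R1 (b - 1)).reverse) (M := S) (S := []) (c := c)
      (d := fun j => if j ≤ k + 1 then Sum.inl c else Sum.inl (Function.update B (k + 1) c j))
      (B := Function.update B (k + 1) c) (by omega)
    have hm2 := sTrans_mul_wordTop (r := r) (n := n)
      (P := rowWord (b - 1) R1 ++ L2.reverse) (M := L1.reverse) (S := S) (c := c)
      (d := fun j => if j ≤ k + 1 then Sum.inl c else Sum.inl (Function.update B (k + 1) c j))
      (B := Function.update B (k + 1) c) (by omega)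
    rw [← e1, ← e2, List.append_nil, List.append_assoc _ S [c]] at hm1
    rw [← e3, ← hins'] at hm2
    have e4 : rowSum ρ b - i = (rowWord (b - 1) R1 ++ L2.reverse).length + 1 := by
      rw [e3, List.length_reverse, hlL1]
      omega
    rw [mul_assoc, halfState, hm1, mul_assoc, e4]
    have e5 : rowWord (b - 1) R1 ++ (R1 (b - 1)).reverse ++ c :: S =
        rowWord (b - 1) R1 ++ L2.reverse ++ L1.reverse ++ c :: S := by
      rw [hL]
      simp
    rw [e5, hm2, ← hlw]
    exact eInt_mul_halfState (by omega) hk (by rw [Function.update_self])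

lemma mem_of_mem_popRow {a d i x : ℕ} {R : ℕ → List ℕ} (h : x ∈ (popRow a d R).2 i) : x ∈ R i := by
  rw [popRow] at h
  split_ifs at h with ha
  · exact h
  · by_cases e : i = a - 1
    · subst e
      simp only [Function.update_self] at h
      exact List.mem_of_mem_tail h
    · simp only at h
      rwa [Function.update_of_ne e] at h

lemma IsFilling.headD_le {k : ℕ} {lam : YoungDiagram} {R : ℕ → List ℕ} {B : ℕ → ℕ}
    (h : IsFilling k lam R B) (i : ℕ) : (R i).headD 0 ≤ k := by
  rcases e : R i with _ | ⟨c, L⟩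
  · exact Nat.zero_le _
  · exact h.le (i := i) (by rw [e]; exact List.mem_cons_self)

lemma IsFilling.step {k : ℕ} {lam μ ρ : YoungDiagram} {R : ℕ → List ℕ} {B : ℕ → ℕ}
    {a b i : ℕ} (hR : IsFilling k lam R B) (h : IsAddStep a μ lam) (h' : IsAddStep b μ ρ)
    (hi : i < insCount b (popRow a (k + 1) R).2) :
    IsFilling (k + 1) ρ (insRow b (popRow a (k + 1) R).1 i (popRow a (k + 1) R).2)
      (Function.update B (k + 1) (popRow a (k + 1) R).1) := by
  have hlen : ∀ i, ((popRow a (k + 1) R).2 i).length = μ.rowLen i := length_popRow hR h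
  have hmem : ∀ i x, x ∈ (popRow a (k + 1) R).2 i → x ∈ R i := fun i x => mem_of_mem_popRow
  have hc : (popRow a (k + 1) R).1 ≤ k + 1 := by
    rw [popRow]
    split_ifs
    · exact le_rfl
    · exact (hR.headD_le _).trans (Nat.le_succ k)
  generalize (popRow a (k + 1) R).1 = c at hlen hmem hc hi ⊢
  generalize (popRow a (k + 1) R).2 = R1 at hlen hmem hc hi ⊢
  constructor
  · intro j
    rw [h' j, ← hlen j, insRow]
    by_cases hb : b = 0
    · rw [if_pos hb, if_neg (by omega), add_zero]
    · rw [insCount, if_neg hb] at hi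
      rw [if_neg hb]
      by_cases e : j = b - 1
      · subst e
        rw [Function.update_self, List.length_insertIdx_of_le_length (by omega), if_pos (by omega)]
      · rw [Function.update_of_ne e, if_neg (by omega), add_zero]
  · intro j x hx
    have : x = c ∨ x ∈ R j := by
      rw [insRow] at hx
      split_ifs at hx with hb
      · exact Or.inr (hmem _ _ hx)
      · by_cases e : j = b - 1
        · subst e
          rw [Function.update_self] at hx
          rcases List.eq_or_mem_of_mem_insertIdx hx with hx | hx
          · exact Or.inl hx
          · exact Or.inr (hmem _ _ hx)
        · rw [Function.update_of_ne e] at hx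
          exact Or.inr (hmem _ _ hx)
    rcases this with rfl | hx
    · exact ⟨k + 1, le_rfl, Function.update_self _ _ _⟩
    · obtain ⟨l, hl, rfl⟩ := hR.exists_eq j x hx
      exact ⟨l, by omega, Function.update_of_ne (by omega) _ _⟩
  · intro j hj
    by_cases e : j = k + 1
    · rw [e, Function.update_self]
      exact hc
    · rw [Function.update_of_ne e]
      have := hR.le_of_le j (by omega)
      omega
  · intro j hj
    rw [Function.update_of_ne (by omega), hR.eq_of_lt j (by omega)]

/-! ### Sums over insertions -/

section Insertion

variable {M : Type} [AddCommGroup M]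

/-- The sum of `f` over all insertions of `c` into a list. -/
def listInsSum (c : ℕ) (f : List ℕ → M) (L : List ℕ) : M :=
  ∑ i ∈ Finset.range (L.length + 1), f (L.insertIdx i c)

lemma listInsSum_nil (c : ℕ) (f : List ℕ → M) : listInsSum c f [] = f [c] := by
  simp [listInsSum]

lemma listInsSum_cons (c b : ℕ) (f : List ℕ → M) (L : List ℕ) :
    listInsSum c f (b :: L) = f (c :: b :: L) + listInsSum c (fun L' => f (b :: L')) L := by
  rw [listInsSum, List.length_cons, Finset.sum_range_succ', add_comm]
  rfl

lemma listInsSum_add (c : ℕ) (f g : List ℕ → M) (L : List ℕ) :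
    listInsSum c (fun L' => f L' + g L') L = listInsSum c f L + listInsSum c g L :=
  Finset.sum_add_distrib

lemma listInsSum_comm (c c' : ℕ) (f : List ℕ → M) (L : List ℕ) :
    listInsSum c (listInsSum c' f) L = listInsSum c' (listInsSum c f) L := by
  induction L generalizing f with
  | nil =>
    simp only [listInsSum_nil, listInsSum_cons]
    exact add_comm _ _
  | cons b L ih =>
    simp only [listInsSum_cons, listInsSum_add, ih]
    abel

/-- The sum of `f` over all insertions of `c` into row `b`. -/
def insSum (b c : ℕ) (f : (ℕ → List ℕ) → M) (R : ℕ → List ℕ) : M :=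
  ∑ i ∈ Finset.range (insCount b R), f (insRow b c i R)

lemma insSum_zero (c : ℕ) (f : (ℕ → List ℕ) → M) (R : ℕ → List ℕ) : insSum 0 c f R = f R := by
  simp [insSum, insCount, insRow]

lemma insSum_of_ne {b : ℕ} (hb : b ≠ 0) (c : ℕ) (f : (ℕ → List ℕ) → M) (R : ℕ → List ℕ) :
    insSum b c f R = listInsSum c (fun L => f (Function.update R (b - 1) L)) (R (b - 1)) := by
  simp [insSum, insCount, insRow, listInsSum, hb]

lemma insSum_congr {b c : ℕ} {f g : (ℕ → List ℕ) → M} {R : ℕ → List ℕ}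
    (h : ∀ i, i < insCount b R → f (insRow b c i R) = g (insRow b c i R)) :
    insSum b c f R = insSum b c g R :=
  Finset.sum_congr rfl fun i hi => h i (Finset.mem_range.1 hi)

lemma insSum_comm (b b' c c' : ℕ) (f : (ℕ → List ℕ) → M) (R : ℕ → List ℕ) :
    insSum b c (insSum b' c' f) R = insSum b' c' (insSum b c f) R := by
  rcases eq_or_ne b 0 with rfl | hb
  · rw [insSum_zero]
    congr 1
    funext R'
    rw [insSum_zero]
  rcases eq_or_ne b' 0 with rfl | hb'
  · rw [insSum_zero]
    congr 1
    funext R'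
    rw [insSum_zero]
  rcases eq_or_ne b b' with rfl | hbb
  · rw [insSum_of_ne hb, insSum_of_ne hb]
    simp only [insSum_of_ne hb, Function.update_self, Function.update_idem]
    exact listInsSum_comm _ _ (fun L => f (Function.update R (b - 1) L)) _
  · have hne : b - 1 ≠ b' - 1 := by omega
    simp only [insSum, insCount, insRow, if_neg hb, if_neg hb', Function.update_of_ne hne,
      Function.update_of_ne hne.symm]
    rw [Finset.sum_comm]
    refine Finset.sum_congr rfl fun i _ => Finset.sum_congr rfl fun j _ => ?_
    rw [Function.update_comm hne]

lemma insSum_map (φ : ℕ → ℕ) (b c : ℕ) (f : (ℕ → List ℕ) → M) (R : ℕ → List ℕ) :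
    insSum b c (fun R' => f fun i => (R' i).map φ) R =
      insSum b (φ c) f fun i => (R i).map φ := by
  rcases eq_or_ne b 0 with rfl | hb
  · rw [insSum_zero, insSum_zero]
  · simp only [insSum, insCount, insRow, if_neg hb, List.length_map]
    refine Finset.sum_congr rfl fun i _ => congrArg f ?_
    funext j
    by_cases e : j = b - 1
    · subst e
      rw [Function.update_self, Function.update_self, List.map_insertIdx]
    · rw [Function.update_of_ne e, Function.update_of_ne e]

/-- A letter is inserted into row `u` of `R`, and the last letter of row `v` is removed. If `u = v`,
this is the inserted letter in one term of the sum, and the last letter of row `v` of `R` in the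
others. If `u ≠ v`, the operations commute. -/
lemma insSum_popRow (u v c d : ℕ) (H : ℕ → (ℕ → List ℕ) → M) (R : ℕ → List ℕ) :
    insSum u c (fun R' => H (popRow v d R').1 (popRow v d R').2) R =
      (if u = v ∧ 0 < v then H c R else 0) +
      if u = v ∧ 0 < v ∧ R (v - 1) = [] then 0
      else insSum u c (H (popRow v d R).1) (popRow v d R).2 := by
  rcases eq_or_ne v 0 with rfl | hv
  · rw [if_neg (by omega), if_neg (by omega), zero_add]
    rfl
  rcases eq_or_ne u v with rfl | huv
  · have hpos : 0 < u := by omega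
    rw [if_pos ⟨rfl, hpos⟩, insSum_of_ne hv]
    rcases e : R (u - 1) with _ | ⟨b, L⟩
    · rw [if_pos ⟨rfl, hpos, rfl⟩, listInsSum_nil, add_zero]
      simp only [popRow, if_neg hv, Function.update_self, List.headD_cons, List.tail_cons,
        Function.update_idem]
      rw [← e, Function.update_eq_self]
    · rw [if_neg (by simp), listInsSum_cons, insSum_of_ne hv]
      simp only [popRow, if_neg hv, Function.update_self, List.headD_cons, List.tail_cons,
        Function.update_idem, e]
      rw [← e, Function.update_eq_self]
  · rw [if_neg (by tauto), if_neg (by tauto), zero_add]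
    rcases eq_or_ne u 0 with rfl | hu
    · rw [insSum_zero, insSum_zero]
    have hne : u - 1 ≠ v - 1 := by omega
    simp only [insSum, insCount, insRow, popRow, if_neg hu, if_neg hv, Function.update_of_ne hne,
      Function.update_of_ne hne.symm]
    refine Finset.sum_congr rfl fun i _ => ?_
    rw [Function.update_comm hne]

end Insertion

lemma mul_insSum (x : PartitionAlgebra r n) (b c : ℕ) (f : (ℕ → List ℕ) → PartitionAlgebra r n)
    (R : ℕ → List ℕ) : x * insSum b c f R = insSum b c (fun R' => x * f R') R :=
  Finset.mul_sum _ _ _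

lemma insSum_mul (x : PartitionAlgebra r n) (b c : ℕ) (f : (ℕ → List ℕ) → PartitionAlgebra r n)
    (R : ℕ → List ℕ) : insSum b c f R * x = insSum b c (fun R' => f R' * x) R :=
  Finset.sum_mul _ _ _

/-! ### Two steps of a path, applied to a state -/

/-- A step of a path removes a letter from a row, joins the vertex `k + 1` to its block, and
inserts it in all possible ways into another row. -/
lemma step_mul_state {k : ℕ} {lam μ ρ : YoungDiagram} {R : ℕ → List ℕ} {B : ℕ → ℕ}
    {a b : ℕ} (hR : IsFilling k lam R B) (h : IsAddStep a μ lam) (h' : IsAddStep b μ ρ)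
    (hk : k < r) (hc : lam.card ≤ k) :
    upAdd r n k ρ b * upSub r n k lam μ a * state r n k (rowWord r R) B =
      insSum b (popRow a (k + 1) R).1 (fun R' => state r n (k + 1) (rowWord r R')
        (Function.update B (k + 1) (popRow a (k + 1) R).1)) (popRow a (k + 1) R).2 := by
  rw [upAdd_mul_upSub, ← insCount_popRow hR h h' (d := k + 1), Finset.sum_mul, insSum]
  exact Finset.sum_congr rfl fun i hi =>
    stepTerm_mul_state hR h h' hk hc (Finset.mem_range.1 hi)

/-- The states which occur after two steps from level `k`, where `k + 1` joins the block of colour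
`c` and `k + 2` joins the one of colour `c'`. -/
def state₂ (r n k : ℕ) (B : ℕ → ℕ) (c c' : ℕ) (R : ℕ → List ℕ) : PartitionAlgebra r n :=
  state r n (k + 2) (rowWord r R) (Function.update (Function.update B (k + 1) c) (k + 2) c')

/-- The part of two steps `-t, +u, -v, +w` from level `k` in which the vertices `k + 1` and `k + 2`
join the last letters of the rows `t` and `v` (after the first has been removed). -/
def mainPart (r n k : ℕ) (B : ℕ → ℕ) (t u v w : ℕ) (R : ℕ → List ℕ) : PartitionAlgebra r n :=
  let p := popRow t (k + 1) R
  let q := popRow v (k + 2) p.2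
  insSum u p.1 (insSum w q.1 (state₂ r n k B p.1 q.1)) q.2

/-- The part of two steps `-t, +u, -u, +w` from level `k` in which the vertices `k + 1` and `k + 2`
join the same block. -/
def errorPart (r n k : ℕ) (B : ℕ → ℕ) (t w : ℕ) (R : ℕ → List ℕ) : PartitionAlgebra r n :=
  let p := popRow t (k + 1) R
  insSum w p.1 (state₂ r n k B p.1 p.1) p.2

lemma two_steps_mul_state {k : ℕ} {lam μ ρ μ' ρ' : YoungDiagram} {R : ℕ → List ℕ} {B : ℕ → ℕ}
    {t u v w : ℕ} (hR : IsFilling k lam R B) (h1 : IsAddStep t μ lam) (h2 : IsAddStep u μ ρ)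
    (h3 : IsAddStep v μ' ρ) (h4 : IsAddStep w μ' ρ') (hk : k + 1 < r) (hc : lam.card ≤ k) :
    upAdd r n (k + 1) ρ' w * upSub r n (k + 1) ρ μ' v *
        (upAdd r n k ρ u * upSub r n k lam μ t) * state r n k (rowWord r R) B =
      (if u = v ∧ 0 < v then errorPart r n k B t w R else 0) +
      if u = v ∧ 0 < v ∧ (popRow t (k + 1) R).2 (v - 1) = [] then 0
      else mainPart r n k B t u v w R := by
  have hρ : ρ.card ≤ k + 1 := by
    have e1 := h1.card_eq
    have e2 := h2.card_eq
    split_ifs at e2 <;> omega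
  rw [mul_assoc, step_mul_state hR h1 h2 (by omega) hc, mul_insSum]
  have := insSum_popRow u v (popRow t (k + 1) R).1 (k + 2)
    (fun c R' => insSum w c (state₂ r n k B (popRow t (k + 1) R).1 c) R') (popRow t (k + 1) R).2
  refine Eq.trans (insSum_congr fun i hi => ?_) this
  exact step_mul_state (hR.step h1 h2 hi) h3 h4 hk hρ

lemma rowWord_map (φ : ℕ → ℕ) (N : ℕ) (R : ℕ → List ℕ) :
    rowWord N (fun i => (R i).map φ) = (rowWord N R).map φ := by
  induction N with
  | zero => rfl
  | succ N ih => rw [rowWord_succ, rowWord_succ, ih, List.map_append, List.map_reverse]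

/-- The exchange of the southern vertices `k + 1` and `k + 2`, if these belong to the same block. -/
lemma state₂_mul_sGen_self {k : ℕ} (hk : k + 1 < r) (B : ℕ → ℕ) (c : ℕ) (R : ℕ → List ℕ) :
    state₂ r n k B c c R * sGen r n (k + 1) = state₂ r n k B c c R := by
  rw [state₂, state, coloured_mul_sGen (by omega) hk]
  apply coloured_congr (fun _ _ _ => rfl)
  intro j _ _
  by_cases e1 : j = k + 1
  · subst e1
    rw [Equiv.swap_apply_left]
    simp
  by_cases e2 : j = k + 2
  · subst e2
    rw [Equiv.swap_apply_right]
    simp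
  rw [Equiv.swap_apply_of_ne_of_ne e1 e2]

/-- The exchange of the southern vertices `k + 1` and `k + 2` amounts to the exchange of the blocks
which they join. A new block is coloured by its first vertex, hence the colours `k + 1` and
`k + 2` are exchanged as well. -/
lemma state₂_mul_sGen {k : ℕ} (hk : k + 1 < r) {B : ℕ → ℕ} (h1 : ∀ j, j ≤ k → B j ≤ k)
    (h2 : ∀ j, k < j → B j = j) (c c' : ℕ) (R : ℕ → List ℕ) :
    state₂ r n k B c c' R * sGen r n (k + 1) =
      state₂ r n k B (Equiv.swap (k + 1) (k + 2) c') (Equiv.swap (k + 1) (k + 2) c)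
        (fun i => (R i).map (Equiv.swap (k + 1) (k + 2))) := by
  rw [state₂, state₂, state, state, coloured_mul_sGen (by omega) hk,
    ← coloured_map (Equiv.swap (k + 1) (k + 2)).injective]
  apply coloured_congr
  · intro j hj _
    rw [rowWord_map]
    by_cases e : j ≤ (rowWord r R).length
    · rw [wordTop_of_le hj e, wordTop_of_le hj (by simpa using e)]
      simp
    · rw [wordTop_of_lt (by omega), wordTop_of_lt (by rw [List.length_map]; omega)]
      split_ifs with e'
      · rfl
      · rw [Function.update_of_ne (by omega), Function.update_of_ne (by omega),
          Function.update_of_ne (by omega), Function.update_of_ne (by omega), h2 j (by omega)]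
        simp only [Sum.map_inl]
        rw [Equiv.swap_apply_of_ne_of_ne (by omega) (by omega)]
  · intro j _ _
    by_cases e1 : j = k + 1
    · subst e1
      simp
    by_cases e2 : j = k + 2
    · subst e2
      simp
    rw [Equiv.swap_apply_of_ne_of_ne (a := k + 1) (b := k + 1 + 1) (x := j) e1 e2,
      Function.update_of_ne e2, Function.update_of_ne e1, Function.update_of_ne e2,
      Function.update_of_ne e1]
    rcases le_or_gt j k with e | e
    · have := h1 j e
      rw [Equiv.swap_apply_of_ne_of_ne (by omega) (by omega)]
    · rw [h2 j e, Equiv.swap_apply_of_ne_of_ne e1 e2]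

lemma errorPart_mul_sGen {k : ℕ} (hk : k + 1 < r) (B : ℕ → ℕ) (t w : ℕ) (R : ℕ → List ℕ) :
    errorPart r n k B t w R * sGen r n (k + 1) = errorPart r n k B t w R := by
  rw [errorPart, insSum_mul]
  simp only [state₂_mul_sGen_self hk]

lemma mainPart_mul_sGen {k : ℕ} {lam : YoungDiagram} {R : ℕ → List ℕ} {B : ℕ → ℕ}
    (hR : IsFilling k lam R B) (hk : k + 1 < r) (t u v w : ℕ) {c c' : ℕ} {R₂ : ℕ → List ℕ}
    (h : popRow v (k + 2) (popRow t (k + 1) R).2 = (c', R₂)) (hc : (popRow t (k + 1) R).1 = c) :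
    mainPart r n k B t u v w R * sGen r n (k + 1) =
      insSum w (Equiv.swap (k + 1) (k + 2) c') (insSum u (Equiv.swap (k + 1) (k + 2) c)
        (state₂ r n k B (Equiv.swap (k + 1) (k + 2) c') (Equiv.swap (k + 1) (k + 2) c))) R₂ := by
  have hmem : ∀ i x, x ∈ R₂ i → x ≤ k := by
    intro i x hx
    have : x ∈ (popRow v (k + 2) (popRow t (k + 1) R).2).2 i := by rwa [h]
    exact hR.le (mem_of_mem_popRow (mem_of_mem_popRow this))
  have hmap : (fun i => (R₂ i).map (Equiv.swap (k + 1) (k + 2))) = R₂ := by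
    funext i
    refine (List.map_congr_left fun x hx => ?_).trans (List.map_id _)
    have := hmem i x hx
    rw [Equiv.swap_apply_of_ne_of_ne (by omega) (by omega), id]
  simp only [mainPart, h, hc, insSum_mul, state₂_mul_sGen hk hR.le_of_le hR.eq_of_lt]
  rw [insSum_comm]
  have e1 : ∀ R', insSum u c (fun R' => state₂ r n k B (Equiv.swap (k + 1) (k + 2) c')
      (Equiv.swap (k + 1) (k + 2) c) (fun i => (R' i).map (Equiv.swap (k + 1) (k + 2)))) R' =
      insSum u (Equiv.swap (k + 1) (k + 2) c) (state₂ r n k B (Equiv.swap (k + 1) (k + 2) c')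
        (Equiv.swap (k + 1) (k + 2) c)) (fun i => (R' i).map (Equiv.swap (k + 1) (k + 2))) :=
    fun R' => insSum_map _ u c _ R'
  have e2 := insSum_map (Equiv.swap (k + 1) (k + 2)) w c'
    (insSum u (Equiv.swap (k + 1) (k + 2) c) (state₂ r n k B (Equiv.swap (k + 1) (k + 2) c')
        (Equiv.swap (k + 1) (k + 2) c))) R₂
  rw [hmap] at e2
  rw [← e2]
  congr 1
  funext R'
  exact e1 R'

/-- If no row loses two letters, the exchange of the vertices `k + 1` and `k + 2`
exchanges the two steps. -/
lemma mainPart_mul_sGen_of_ne {k : ℕ} {lam : YoungDiagram} {R : ℕ → List ℕ} {B : ℕ → ℕ}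
    (hR : IsFilling k lam R B) (hk : k + 1 < r) {t u v w : ℕ} (htv : t = v → t = 0) :
    mainPart r n k B t u v w R * sGen r n (k + 1) = mainPart r n k B v w t u R := by
  have hfix : ∀ i, Equiv.swap (k + 1) (k + 2) ((R i).headD 0) = (R i).headD 0 := by
    intro i
    have := hR.headD_le i
    rw [Equiv.swap_apply_of_ne_of_ne (by omega) (by omega)]
  rcases eq_or_ne t 0 with rfl | ht
  · rw [mainPart_mul_sGen hR hk 0 u v w Prod.mk.eta.symm rfl]
    rcases eq_or_ne v 0 with rfl | hv
    · simp [mainPart, popRow]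
    · simp only [mainPart, popRow, if_true, if_neg hv, hfix, Equiv.swap_apply_left]
  · rcases eq_or_ne v 0 with rfl | hv
    · rw [mainPart_mul_sGen hR hk t u 0 w Prod.mk.eta.symm rfl]
      simp only [mainPart, popRow, if_true, if_neg ht, hfix, Equiv.swap_apply_right]
    · have hne : t - 1 ≠ v - 1 := by
        intro e
        have : t = v := by omega
        exact ht (htv this)
      rw [mainPart_mul_sGen hR hk t u v w Prod.mk.eta.symm rfl]
      simp only [mainPart, popRow, if_neg ht, if_neg hv, hfix, Function.update_of_ne hne,
        Function.update_of_ne hne.symm]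
      rw [Function.update_comm hne]

/-- If both letters are removed from row `t`, the exchange of the vertices `k + 1` and `k + 2` has
to be combined with the exchange of the last two letters of the row. -/
lemma mainPart_mul_sGen_self {k : ℕ} {lam : YoungDiagram} {R : ℕ → List ℕ} {B : ℕ → ℕ}
    (hR : IsFilling k lam R B) (hk : k + 1 < r) {t u w a b : ℕ} {L : List ℕ} (ht : t ≠ 0)
    (hL : R (t - 1) = a :: b :: L) :
    mainPart r n k B t u t w R * sGen r n (k + 1) =
      mainPart r n k B t w t u (Function.update R (t - 1) (b :: a :: L)) := by
  have ha : a ≤ k := hR.le (i := t - 1) (by rw [hL]; simp)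
  have hb : b ≤ k := hR.le (i := t - 1) (by rw [hL]; simp)
  rw [mainPart_mul_sGen hR hk t u t w Prod.mk.eta.symm rfl]
  simp only [mainPart, popRow, if_neg ht, hL, Function.update_self, List.headD_cons,
    List.tail_cons, Function.update_idem]
  rw [Equiv.swap_apply_of_ne_of_ne (by omega) (by omega),
    Equiv.swap_apply_of_ne_of_ne (by omega) (by omega)]

/-! ### Exchanges of neighbouring letters of a row -/

/-- The exchange of the entries `j` and `j + 1` of a list. -/
def swapAt : ℕ → List ℕ → List ℕ
  | 0, a :: b :: L => b :: a :: L
  | j + 1, a :: L => a :: swapAt j L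
  | _, L => L

lemma length_swapAt (j : ℕ) (L : List ℕ) : (swapAt j L).length = L.length := by
  induction L generalizing j with
  | nil => cases j <;> rfl
  | cons a L ih =>
    rcases j with _ | j
    · rcases L with _ | ⟨b, L⟩ <;> rfl
    · simp [swapAt, ih]

lemma mem_swapAt {j x : ℕ} {L : List ℕ} : x ∈ swapAt j L ↔ x ∈ L := by
  induction L generalizing j with
  | nil => cases j <;> rfl
  | cons a L ih =>
    rcases j with _ | j
    · rcases L with _ | ⟨b, L⟩
      · rfl
      · simp only [swapAt, List.mem_cons]
        tauto
    · simp [swapAt, ih]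

lemma exists_swapAt {j : ℕ} {L : List ℕ} (h : j + 2 ≤ L.length) :
    ∃ L₁ a b L₂, L₁.length = j ∧ L = L₁ ++ a :: b :: L₂ ∧ swapAt j L = L₁ ++ b :: a :: L₂ := by
  induction L generalizing j with
  | nil => simp at h
  | cons a L ih =>
    rcases j with _ | j
    · rcases L with _ | ⟨b, L⟩
      · simp at h
      · exact ⟨[], a, b, L, rfl, rfl, rfl⟩
    · obtain ⟨L₁, c, d, L₂, h1, h2, h3⟩ := ih (j := j) (by simpa using h)
      exact ⟨a :: L₁, c, d, L₂, by simp [h1], by simp [h2], by simp [swapAt, h3]⟩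

/-- An exchange of two neighbouring entries after an insertion: if the inserted letter is one of
them, it is inserted at the other place; otherwise the exchange can be made before the insertion. -/
lemma swapAt_insertIdx {i j c : ℕ} {L : List ℕ} (hi : i ≤ L.length) (hj : j + 1 ≤ L.length) :
    swapAt j (L.insertIdx i c) =
      if i < j then (swapAt (j - 1) L).insertIdx i c
      else if j + 1 < i then (swapAt j L).insertIdx i c
      else L.insertIdx (Equiv.swap j (j + 1) i) c := by
  induction j generalizing i L with
  | zero =>
    rw [if_neg (by omega)]
    rcases L with _ | ⟨a, L⟩
    · simp at hj
    rcases i with _ | _ | i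
    · rfl
    · simp [swapAt]
    · rw [if_pos (by omega)]
      rcases L with _ | ⟨b, L⟩
      · simp at hi
      · rfl
  | succ j ih =>
    rcases L with _ | ⟨a, L⟩
    · simp at hj
    rcases i with _ | i
    · rw [if_pos (by omega)]
      rfl
    · rw [List.length_cons] at hi hj
      have := ih (i := i) (L := L) (by omega) (by omega)
      rw [List.insertIdx_succ_cons, swapAt, this]
      by_cases e1 : i < j
      · rw [if_pos e1, if_pos (by omega)]
        obtain ⟨j, rfl⟩ : ∃ j', j = j' + 1 := ⟨j - 1, by omega⟩
        rfl
      · rw [if_neg e1, if_neg (by omega : ¬ (i + 1 < j + 1))]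
        by_cases e2 : j + 1 < i
        · rw [if_pos e2, if_pos (by omega : j + 1 + 1 < i + 1)]
          rfl
        · rw [if_neg e2, if_neg (by omega : ¬ (j + 1 + 1 < i + 1))]
          rcases (by omega : i = j ∨ i = j + 1) with rfl | rfl
          · rw [Equiv.swap_apply_left, Equiv.swap_apply_left]
            rfl
          · rw [Equiv.swap_apply_right, Equiv.swap_apply_right]
            rfl

/-- The exchange of the letters `j` and `j + 1` of row `q`. -/
def swapRow (q j : ℕ) (R : ℕ → List ℕ) : ℕ → List ℕ := Function.update R q (swapAt j (R q))

lemma IsFilling.swapRow {k : ℕ} {lam : YoungDiagram} {R : ℕ → List ℕ} {B : ℕ → ℕ}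
    (h : IsFilling k lam R B) (q j : ℕ) : IsFilling k lam (swapRow q j R) B := by
  refine ⟨fun i => ?_, fun i c hc => h.exists_eq i c ?_, h.le_of_le, h.eq_of_lt⟩
  · by_cases e : i = q
    · subst e
      rw [PartitionAlg.swapRow, Function.update_self, length_swapAt, h.length_eq]
    · rw [PartitionAlg.swapRow, Function.update_of_ne e, h.length_eq]
  · by_cases e : i = q
    · subst e
      rw [PartitionAlg.swapRow, Function.update_self, mem_swapAt] at hc
      exact hc
    · rwa [PartitionAlg.swapRow, Function.update_of_ne e] at hc

/-- The Coxeter generator which exchanges the letters `j` and `j + 1` (counted from the right,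
starting with `0`) of row `q` of a word of shape `lam`. -/
def rowGen (r n : ℕ) (lam : YoungDiagram) (q j : ℕ) : PartitionAlgebra r n :=
  sGen r n (rowSum lam q + (lam.rowLen q - (j + 1)))

lemma rowGen_mul_state {k : ℕ} {lam : YoungDiagram} {R : ℕ → List ℕ} {B : ℕ → ℕ}
    (hR : IsFilling k lam R B) (hc : lam.card ≤ k) (hk : k ≤ r) {q j : ℕ}
    (hj : j + 2 ≤ lam.rowLen q) :
    rowGen r n lam q j * state r n k (rowWord r R) B =
      state r n k (rowWord r (swapRow q j R)) B := by
  have hq : q < r := by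
    by_contra hq
    have h1 := rowLen_eq_zero_of_card_le (μ := lam) (i := q) (by omega)
    omega
  obtain ⟨S, hS⟩ := exists_rowWord_update hq R
  rw [← hR.length_eq] at hj
  obtain ⟨L₁, a, b, L₂, h1, h2, h3⟩ := exists_swapAt hj
  have hw : rowWord r R = (rowWord q R ++ L₂.reverse) ++ b :: a :: (L₁.reverse ++ S) := by
    have := hS (R q)
    rw [Function.update_eq_self] at this
    rw [this, h2]
    simp
  have hw' : rowWord r (swapRow q j R) =
      (rowWord q R ++ L₂.reverse) ++ a :: b :: (L₁.reverse ++ S) := by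
    rw [swapRow, hS, h3]
    simp
  have hlen : (rowWord r R).length = lam.card := by
    rw [hR.length_rowWord, card_eq_rowSum (N := r) (by omega)]
  have hidx : rowSum lam q + (lam.rowLen q - (j + 1)) =
      (rowWord q R ++ L₂.reverse).length + 1 := by
    rw [List.length_append, hR.length_rowWord, ← hR.length_eq q, h2, List.length_reverse]
    simp only [List.length_append, List.length_cons]
    omega
  rw [hw, List.length_append, List.length_cons, List.length_cons] at hlen
  rw [rowGen, hidx, state, state, hw, hw']
  exact sGen_mul_wordTop (by omega)

/-- An exchange in row `q` after the removal of a letter is an exchange before the removal,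
shifted by one place if the letter is removed from row `q`. -/
lemma popRow_swapRow {a d q j : ℕ} {R : ℕ → List ℕ}
    (h : j + 2 ≤ ((popRow a d R).2 q).length) :
    popRow a d (swapRow q (if q + 1 = a then j + 1 else j) R) =
      ((popRow a d R).1, swapRow q j (popRow a d R).2) := by
  rcases eq_or_ne a 0 with rfl | ha
  · simp [popRow]
  by_cases e : q + 1 = a
  · subst e
    simp only [popRow, if_neg ha, if_true, Nat.add_sub_cancel, Function.update_self] at h ⊢
    rcases e : R q with _ | ⟨c, L⟩
    · rw [e] at h
      simp at h
    · simp [swapRow, swapAt, e]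
  · have hne : a - 1 ≠ q := by omega
    simp only [popRow, if_neg ha, if_neg e, swapRow, Function.update_of_ne hne,
      Function.update_of_ne hne.symm]
    rw [Function.update_comm hne]

/-! ### The span of the states and its invariants -/

/-- The span of the states of level `k` and shape `lam`. -/
def stateSpan (r n k : ℕ) (lam : YoungDiagram) : Submodule ℚ (PartitionAlgebra r n) :=
  Submodule.span ℚ {x | ∃ R B, IsFilling k lam R B ∧ x = state r n k (rowWord r R) B}

/-- Identities between multiplication operators can be checked on states. -/
lemma mul_eq_mul_of_mem_stateSpan {k : ℕ} {lam : YoungDiagram} {x y X z : PartitionAlgebra r n}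
    (hX : X ∈ stateSpan r n k lam)
    (h : ∀ R B, IsFilling k lam R B →
      x * state r n k (rowWord r R) B * z = y * state r n k (rowWord r R) B) :
    x * X * z = y * X := by
  rw [stateSpan] at hX
  induction hX using Submodule.span_induction with
  | mem X hX =>
    obtain ⟨R, B, hR, rfl⟩ := hX
    exact h R B hR
  | zero => simp
  | add X Y _ _ hX hY => rw [mul_add, add_mul, hX, hY, mul_add]
  | smul c X _ hX => rw [mul_smul_comm, smul_mul_assoc, hX, mul_smul_comm]

/-- The elements which are invariant under the row stabilizer of `lam` in the span of the states of
level `k` and shape `lam`. -/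
structure IsRowInvariant (k : ℕ) (lam : YoungDiagram) (X : PartitionAlgebra r n) : Prop where
  mem : X ∈ stateSpan r n k lam
  rowGen_mul : ∀ q j, j + 2 ≤ lam.rowLen q → rowGen r n lam q j * X = X

/-- A transposition within row `q` permutes the terms of a step: it moves the inserted letter, or is
absorbed by the invariance of `X`. -/
lemma rowGen_mul_stepTerm {k : ℕ} {lam μ ρ : YoungDiagram} {X : PartitionAlgebra r n}
    {a b i q j : ℕ} (hX : IsRowInvariant k lam X) (h : IsAddStep a μ lam) (h' : IsAddStep b μ ρ)
    (hk : k < r) (hc : lam.card ≤ k) (hi : i < if b = 0 then 1 else ρ.rowLen (b - 1))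
    (hj : j + 2 ≤ ρ.rowLen q) :
    rowGen r n ρ q j * (stepTerm r n k lam μ ρ a b i * X) =
      stepTerm r n k lam μ ρ a b (if q + 1 = b then Equiv.swap j (j + 1) i else i) * X := by
  have hμ := h' q
  have hlam := h q
  have hρc : ρ.card ≤ k + 1 := by
    have e1 := h.card_eq
    have e2 := h'.card_eq
    split_ifs at e2 <;> omega
  -- An exchange in row `q` after the step is one before the step.
  have key : ∀ i' j', i' < (if b = 0 then 1 else ρ.rowLen (b - 1)) → j' + 2 ≤ μ.rowLen q →
      (∀ c, ∀ R : ℕ → List ℕ, (∀ p, (R p).length = μ.rowLen p) →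
        swapRow q j (insRow b c i R) = insRow b c i' (swapRow q j' R)) →
      rowGen r n ρ q j * (stepTerm r n k lam μ ρ a b i * X) =
        stepTerm r n k lam μ ρ a b i' * X := by
    intro i' j' hi' hj' hcomm
    have hj'' : (if q + 1 = a then j' + 1 else j') + 2 ≤ lam.rowLen q := by
      rw [hlam]
      split_ifs <;> omega
    have e := mul_eq_mul_of_mem_stateSpan (z := 1) (x := rowGen r n ρ q j *
      stepTerm r n k lam μ ρ a b i) (y := stepTerm r n k lam μ ρ a b i' *
        rowGen r n lam q (if q + 1 = a then j' + 1 else j')) hX.mem ?_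
    · rw [mul_one, mul_assoc, mul_assoc, hX.rowGen_mul _ _ hj''] at e
      exact e
    · intro R B hR
      have hlen : ∀ p, ((popRow a (k + 1) R).2 p).length = μ.rowLen p := length_popRow hR h
      have hi₁ : i < insCount b (popRow a (k + 1) R).2 := by
        rwa [insCount_popRow hR h h']
      have hpop := popRow_swapRow (a := a) (d := k + 1) (q := q) (j := j') (R := R)
        (by rw [hlen]; exact hj')
      have hi₂ : i' < insCount b (popRow a (k + 1) (swapRow q
          (if q + 1 = a then j' + 1 else j') R)).2 := by
        rwa [insCount_popRow (hR.swapRow _ _) h h']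
      rw [mul_one, mul_assoc, mul_assoc, stepTerm_mul_state hR h h' hk hc hi₁,
        rowGen_mul_state (hR.step h h' hi₁) hρc hk hj, rowGen_mul_state hR hc hk.le hj'',
        stepTerm_mul_state (hR.swapRow _ _) h h' hk hc hi₂, hpop, hcomm _ _ hlen]
  by_cases hqb : q + 1 = b
  · subst hqb
    rw [if_pos rfl]
    rw [if_pos rfl] at hμ
    rw [if_neg (by omega), Nat.add_sub_cancel] at hi
    have hins : ∀ c i' (R : ℕ → List ℕ), insRow (q + 1) c i' R =
        Function.update R q ((R q).insertIdx i' c) := by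
      intro c i' R
      rw [insRow, if_neg (by omega), Nat.add_sub_cancel]
    by_cases e1 : i < j
    · rw [Equiv.swap_apply_of_ne_of_ne (by omega) (by omega)]
      refine key i (j - 1) (by rwa [if_neg (by omega), Nat.add_sub_cancel]) (by omega) ?_
      intro c R hR
      rw [hins, hins, swapRow, swapRow, Function.update_self, Function.update_self,
        Function.update_idem, Function.update_idem, swapAt_insertIdx (by rw [hR]; omega)
          (by rw [hR]; omega), if_pos e1]
    · by_cases e2 : j + 1 < i
      · rw [Equiv.swap_apply_of_ne_of_ne (by omega) (by omega)]
        refine key i j (by rwa [if_neg (by omega), Nat.add_sub_cancel]) (by omega) ?_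
        intro c R hR
        rw [hins, hins, swapRow, swapRow, Function.update_self, Function.update_self,
          Function.update_idem, Function.update_idem, swapAt_insertIdx (by rw [hR]; omega)
            (by rw [hR]; omega), if_neg e1, if_pos e2]
      · -- One of the two exchanged letters is the inserted one.
        have hs : Equiv.swap j (j + 1) i ≤ j + 1 := by
          rcases (by omega : i = j ∨ i = j + 1) with rfl | rfl
          · rw [Equiv.swap_apply_left]
          · rw [Equiv.swap_apply_right]
            omega
        have e := mul_eq_mul_of_mem_stateSpan (z := 1) (x := rowGen r n ρ q j *
          stepTerm r n k lam μ ρ a (q + 1) i)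
          (y := stepTerm r n k lam μ ρ a (q + 1) (Equiv.swap j (j + 1) i)) hX.mem ?_
        · rwa [mul_one, mul_assoc] at e
        · intro R B hR
          have hlen : ∀ p, ((popRow a (k + 1) R).2 p).length = μ.rowLen p := length_popRow hR h
          have hcnt : ∀ i', i' < ρ.rowLen q → i' < insCount (q + 1) (popRow a (k + 1) R).2 := by
            intro i' hi'
            rwa [insCount_popRow hR h h', if_neg (by omega), Nat.add_sub_cancel]
          rw [mul_one, mul_assoc, stepTerm_mul_state hR h h' hk hc (hcnt i hi),
            rowGen_mul_state (hR.step h h' (hcnt i hi)) hρc hk hj,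
            stepTerm_mul_state hR h h' hk hc (hcnt _ (by omega)), hins, hins, swapRow,
            Function.update_self, Function.update_idem,
            swapAt_insertIdx (by rw [hlen]; omega) (by rw [hlen]; omega), if_neg e1, if_neg e2]
  · rw [if_neg hqb]
    rw [if_neg hqb] at hμ
    refine key i j hi (by omega) ?_
    intro c R _
    rw [insRow, insRow]
    split_ifs with hb
    · rfl
    · have hne : q ≠ b - 1 := by omega
      simp only [swapRow, Function.update_of_ne hne, Function.update_of_ne hne.symm]
      rw [Function.update_comm hne]

lemma IsRowInvariant.step {k : ℕ} {lam μ ρ : YoungDiagram} {X : PartitionAlgebra r n}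
    {a b : ℕ} (hX : IsRowInvariant k lam X) (h : IsAddStep a μ lam) (h' : IsAddStep b μ ρ)
    (hk : k < r) (hc : lam.card ≤ k) :
    IsRowInvariant (k + 1) ρ (upAdd r n k ρ b * upSub r n k lam μ a * X) := by
  constructor
  · have hmem := hX.mem
    rw [stateSpan] at hmem
    clear hX
    induction hmem using Submodule.span_induction with
    | mem X hX =>
      obtain ⟨R, B, hR, rfl⟩ := hX
      rw [step_mul_state hR h h' hk hc]
      refine Submodule.sum_mem _ fun i hi => Submodule.subset_span ⟨_, _, ?_, rfl⟩
      exact hR.step h h' (Finset.mem_range.1 hi)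
    | zero => rw [mul_zero]; exact Submodule.zero_mem _
    | add X Y _ _ hX hY => rw [mul_add]; exact Submodule.add_mem _ hX hY
    | smul c X _ hX => rw [mul_smul_comm]; exact Submodule.smul_mem _ _ hX
  · intro q j hj
    rw [upAdd_mul_upSub, Finset.sum_mul, Finset.mul_sum]
    rw [Finset.sum_congr rfl fun i hi =>
      rowGen_mul_stepTerm hX h h' hk hc (Finset.mem_range.1 hi) hj]
    by_cases hqb : q + 1 = b
    · subst hqb
      simp only [if_true]
      rw [if_neg (by omega), Nat.add_sub_cancel]
      refine Finset.sum_equiv (Equiv.swap j (j + 1)) ?_ fun _ _ => rfl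
      intro i
      rw [Finset.mem_range, Finset.mem_range]
      by_cases e1 : i = j
      · subst e1
        rw [Equiv.swap_apply_left]
        omega
      by_cases e2 : i = j + 1
      · subst e2
        rw [Equiv.swap_apply_right]
        omega
      rw [Equiv.swap_apply_of_ne_of_ne e1 e2]
    · simp only [if_neg hqb]

/-! ### The relation on two consecutive steps -/

lemma rowLen_rowCount (μ : YoungDiagram) : μ.rowLen (rowCount μ) = 0 := by
  by_contra h
  have : (rowCount μ, 0) ∈ μ := YoungDiagram.mem_iff_lt_rowLen.2 (Nat.pos_of_ne_zero h)
  rw [YoungDiagram.mem_iff_lt_colLen] at this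
  exact lt_irrefl _ this

/-- The product of the up branching coefficients of the steps `-a, +b` from level `k`. -/
def stepElt (r n k : ℕ) (lam μ ρ : YoungDiagram) (a b : ℕ) : PartitionAlgebra r n :=
  upAdd r n k ρ b * upSub r n k lam μ a

/-- The product of the coefficients of two steps `-t, +L, -L, +w`, where `L` is the number of the
first empty row. -/
def errorElt (r n k : ℕ) (lam μ μ' ρ' : YoungDiagram) (t w : ℕ) : PartitionAlgebra r n :=
  stepElt r n (k + 1) (addNewRow μ) μ' ρ' (rowCount μ + 1) w *
    stepElt r n k lam μ (addNewRow μ) t (rowCount μ + 1)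

lemma IsAddStep.left_unique {μ μ' ρ : YoungDiagram} {a : ℕ} (h : IsAddStep a μ ρ)
    (h' : IsAddStep a μ' ρ) : μ' = μ :=
  ext_rowLen fun i => by
    have h1 := h i
    have h2 := h' i
    omega

/-- The path through the first empty row contributes exactly the terms in which both vertices join
the same block, since the inserted block is the only one of its row. -/
lemma errorElt_mul_state {k : ℕ} {lam μ ρ μ' ρ' : YoungDiagram} {R : ℕ → List ℕ} {B : ℕ → ℕ}
    {t u w : ℕ} (hR : IsFilling k lam R B) (h1 : IsAddStep t μ lam) (h2 : IsAddStep u μ ρ)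
    (h3 : IsAddStep u μ' ρ) (h4 : IsAddStep w μ' ρ') (hk : k + 1 < r) (hc : lam.card ≤ k) :
    errorElt r n k lam μ μ' ρ' t w * state r n k (rowWord r R) B = errorPart r n k B t w R := by
  obtain rfl := h2.left_unique h3
  have hadd := isAddStep_addNewRow μ'
  have hnil : (popRow t (k + 1) R).2 (rowCount μ' + 1 - 1) = [] := by
    rw [← List.length_eq_zero_iff, length_popRow hR h1, Nat.add_sub_cancel, rowLen_rowCount]
  have := two_steps_mul_state (n := n) hR h1 hadd hadd h4 hk hc
  rw [if_pos ⟨rfl, Nat.succ_pos _⟩, if_pos ⟨rfl, Nat.succ_pos _, hnil⟩, add_zero] at this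
  exact this

/-- The coefficients of two steps, without the part in which both vertices join the same block. -/
def mainElt (r n k : ℕ) (lam μ ρ μ' ρ' : YoungDiagram) (t u v w : ℕ) : PartitionAlgebra r n :=
  stepElt r n (k + 1) ρ μ' ρ' v w * stepElt r n k lam μ ρ t u -
    if u = v ∧ 0 < v then errorElt r n k lam μ μ' ρ' t w else 0

lemma mainElt_mul_state {k : ℕ} {lam μ ρ μ' ρ' : YoungDiagram} {R : ℕ → List ℕ} {B : ℕ → ℕ}
    {t u v w : ℕ} (hR : IsFilling k lam R B) (h1 : IsAddStep t μ lam) (h2 : IsAddStep u μ ρ)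
    (h3 : IsAddStep v μ' ρ) (h4 : IsAddStep w μ' ρ') (hk : k + 1 < r) (hc : lam.card ≤ k) :
    mainElt r n k lam μ ρ μ' ρ' t u v w * state r n k (rowWord r R) B =
      if u = v ∧ 0 < v ∧ μ.rowLen (v - 1) = 0 then 0 else mainPart r n k B t u v w R := by
  have := two_steps_mul_state (n := n) hR h1 h2 h3 h4 hk hc
  have hnil : (popRow t (k + 1) R).2 (v - 1) = [] ↔ μ.rowLen (v - 1) = 0 := by
    rw [← List.length_eq_zero_iff, length_popRow hR h1]
  simp only [hnil] at this
  rw [mainElt, sub_mul, stepElt, stepElt, this]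
  by_cases huv : u = v ∧ 0 < v
  · rw [if_pos huv, if_pos huv]
    obtain ⟨rfl, -⟩ := huv
    rw [errorElt_mul_state hR h1 h2 h3 h4 hk hc, add_sub_cancel_left]
  · rw [if_neg huv, if_neg huv, zero_add, zero_mul, sub_zero]

/-- On row invariant elements, `s_{k+1,k+2}` exchanges the main parts of the two paths. -/
lemma mainElt_mul_sGen {k : ℕ} {lam μ ρ μ' ρ' κ σ κ' : YoungDiagram} {X : PartitionAlgebra r n}
    {t u v w : ℕ} (hX : IsRowInvariant k lam X) (hk : k + 1 < r) (hc : lam.card ≤ k)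
    (h1 : IsAddStep t μ lam) (h2 : IsAddStep u μ ρ) (h3 : IsAddStep v μ' ρ)
    (h4 : IsAddStep w μ' ρ') (g1 : IsAddStep v κ lam) (g2 : IsAddStep w κ σ)
    (g3 : IsAddStep t κ' σ) (g4 : IsAddStep u κ' ρ') :
    mainElt r n k lam μ ρ μ' ρ' t u v w * X * sGen r n (k + 1) =
      mainElt r n k lam κ σ κ' ρ' v w t u * X := by
  by_cases htv : t = v → t = 0
  · -- No row loses two letters.
    refine mul_eq_mul_of_mem_stateSpan hX.mem fun R B hR => ?_
    rw [mainElt_mul_state hR h1 h2 h3 h4 hk hc, mainElt_mul_state hR g1 g2 g3 g4 hk hc, if_neg,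
      if_neg, mainPart_mul_sGen_of_ne hR hk htv]
    · rintro ⟨-, ht, h0⟩
      have e1 := g1 (t - 1)
      have e2 := h1 (t - 1)
      rw [if_neg (by omega)] at e1
      rw [if_pos (by omega)] at e2
      omega
    · rintro ⟨-, hv, h0⟩
      have e1 := g1 (v - 1)
      have e2 := h1 (v - 1)
      rw [if_pos (by omega)] at e1
      rw [if_neg (by omega)] at e2
      omega
  · push Not at htv
    obtain ⟨rfl, ht⟩ := htv
    obtain rfl := h1.left_unique g1
    have e1 := h1 (t - 1)
    rw [if_pos (by omega)] at e1
    rcases Nat.eq_zero_or_pos (κ.rowLen (t - 1)) with h0 | h0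
    · -- The row has only one letter. It is returned to the row and removed again.
      have hu : u = t := by
        by_contra hu
        have e2 := h2 (t - 1)
        have e3 := h3 (t - 1)
        rw [if_neg (by omega)] at e2
        rw [if_pos (by omega)] at e3
        omega
      have hw : w = t := by
        by_contra hw
        have e2 := g2 (t - 1)
        have e3 := g3 (t - 1)
        rw [if_neg (by omega)] at e2
        rw [if_pos (by omega)] at e3
        omega
      refine mul_eq_mul_of_mem_stateSpan hX.mem fun R B hR => ?_
      rw [mainElt_mul_state hR h1 h2 h3 h4 hk hc, mainElt_mul_state hR g1 g2 g3 g4 hk hc,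
        if_pos ⟨hu, by omega, h0⟩, if_pos ⟨hw, by omega, h0⟩, zero_mul]
    · -- The invariance of `X` allows to symmetrize over the last two letters of the row.
      set g := rowGen r n lam (t - 1) 0
      have hg : g * X = X := hX.rowGen_mul _ _ (by omega)
      have key := mul_eq_mul_of_mem_stateSpan (z := sGen r n (k + 1))
        (x := mainElt r n k lam κ ρ μ' ρ' t u t w * (1 + g))
        (y := mainElt r n k lam κ σ κ' ρ' t w t u * (1 + g)) hX.mem ?_
      · rw [mul_assoc _ (1 + g) X, mul_assoc _ (1 + g) X, add_mul, hg, one_mul, mul_add, add_mul,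
          mul_add] at key
        have half : ∀ Y : PartitionAlgebra r n, Y = (1 / 2 : ℚ) • (Y + Y) := by
          intro Y
          module
        rw [half (_ * X * _), key, ← half]
      · intro R B hR
        have hlen : 0 + 2 ≤ (R (t - 1)).length := by
          rw [hR.length_eq]
          omega
        obtain ⟨L₁, a, b, L, hL₁, hL, -⟩ := exists_swapAt hlen
        obtain rfl := List.length_eq_zero_iff.1 hL₁
        rw [List.nil_append] at hL
        set R' := Function.update R (t - 1) (b :: a :: L) with hR'
        have hswap : swapRow (t - 1) 0 R = R' := by
          rw [swapRow, hL]
          rfl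
        have hfill : IsFilling k lam R' B := hswap ▸ hR.swapRow (t - 1) 0
        have hg' : g * state r n k (rowWord r R) B = state r n k (rowWord r R') B := by
          rw [rowGen_mul_state hR hc (by omega) (by omega), hswap]
        have hback : Function.update R' (t - 1) (a :: b :: L) = R := by
          rw [hR', Function.update_idem, ← hL, Function.update_eq_self]
        have hm := mainPart_mul_sGen_self (n := n) (u := u) (w := w) hR hk ht hL
        have hm' := mainPart_mul_sGen_self (n := n) (u := u) (w := w) (a := b) (b := a) (L := L)
          hfill hk ht (by rw [hR', Function.update_self])
        rw [hback] at hm'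
        rw [mul_assoc _ (1 + g), mul_assoc _ (1 + g), add_mul, hg', one_mul, mul_add, add_mul,
          mul_add, mainElt_mul_state hR h1 h2 h3 h4 hk hc, mainElt_mul_state hR g1 g2 g3 g4 hk hc,
          mainElt_mul_state hfill h1 h2 h3 h4 hk hc, mainElt_mul_state hfill g1 g2 g3 g4 hk hc,
          if_neg (by omega), if_neg (by omega), if_neg (by omega), if_neg (by omega), hm, hm',
          add_comm]

/-- The relation of the theorem, for the factors of the two steps around the level `k + 1`. Here
`X` stands for the product of the earlier factors. -/
lemma two_steps_mul_sGen {k : ℕ} {lam μ ρ μ' ρ' κ σ κ' : YoungDiagram} {X : PartitionAlgebra r n}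
    {t u v w : ℕ} (hX : IsRowInvariant k lam X) (hk : k + 1 < r) (hc : lam.card ≤ k)
    (h1 : IsAddStep t μ lam) (h2 : IsAddStep u μ ρ) (h3 : IsAddStep v μ' ρ)
    (h4 : IsAddStep w μ' ρ') (g1 : IsAddStep v κ lam) (g2 : IsAddStep w κ σ)
    (g3 : IsAddStep t κ' σ) (g4 : IsAddStep u κ' ρ') :
    stepElt r n (k + 1) ρ μ' ρ' v w * (stepElt r n k lam μ ρ t u * X) * sGen r n (k + 1) =
      stepElt r n (k + 1) σ κ' ρ' t u * (stepElt r n k lam κ σ v w * X) +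
        (if u = v ∧ 0 < v then errorElt r n k lam μ μ' ρ' t w * X else 0) -
        if w = t ∧ 0 < t then errorElt r n k lam κ κ' ρ' v u * X else 0 := by
  have hmain := mainElt_mul_sGen hX hk hc h1 h2 h3 h4 g1 g2 g3 g4
  have herr : (if u = v ∧ 0 < v then errorElt r n k lam μ μ' ρ' t w else 0) * X *
      sGen r n (k + 1) = (if u = v ∧ 0 < v then errorElt r n k lam μ μ' ρ' t w else 0) * X := by
    split_ifs with huv
    · obtain ⟨rfl, -⟩ := huv
      refine mul_eq_mul_of_mem_stateSpan hX.mem fun R B hR => ?_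
      rw [errorElt_mul_state hR h1 h2 h3 h4 hk hc, errorPart_mul_sGen hk]
    · rw [zero_mul, zero_mul]
  rw [mainElt, mainElt, sub_mul, sub_mul, sub_mul, herr] at hmain
  have hite : ∀ (p : Prop) [Decidable p] (Y : PartitionAlgebra r n),
      (if p then Y * X else 0) = (if p then Y else 0) * X := by
    intro p _ Y
    split_ifs
    · rfl
    · rw [zero_mul]
  rw [hite, hite, ← mul_assoc, ← mul_assoc, sub_eq_iff_eq_add.1 hmain]
  abel

/-! ### Products along a path -/

namespace KroneckerTableau

variable {ν : YoungDiagram}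

/-- The factor of `u_𝔱` which belongs to the steps from level `j` to level `j + 1`. -/
def factor (n : ℕ) (t : KroneckerTableau r ν) (j : ℕ) : PartitionAlgebra r n :=
  if h : j < r then
    stepElt r n j (t.shape ⟨j, by omega⟩) (t.half ⟨j, h⟩) (t.shape ⟨j + 1, by omega⟩)
      (t.sub ⟨j, h⟩) (t.add ⟨j, h⟩) else 1

/-- The product of the factors of `u_𝔱` up to level `m`. -/
def upTo (n : ℕ) (t : KroneckerTableau r ν) : ℕ → PartitionAlgebra r n
  | 0 => 1
  | m + 1 => t.factor n m * t.upTo n m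

lemma up_eq_upTo (t : KroneckerTableau r ν) : t.up n = t.upTo n r := by
  have hprod : ∀ m, t.upTo n m = ((List.range m).reverse.map (t.factor n)).prod := by
    intro m
    induction m with
    | zero => rfl
    | succ m ih => rw [upTo, ih, List.range_succ]; simp
  rw [hprod, up, ← List.map_coe_finRange_eq_range, ← List.map_reverse, List.map_map]
  congr 1
  apply List.map_congr_left
  intro j _
  rw [Function.comp_apply, factor, dif_pos j.2]
  rfl

lemma upTo_congr {t t' : KroneckerTableau r ν} {m : ℕ}
    (h : ∀ j, j < m → t'.factor n j = t.factor n j) : t'.upTo n m = t.upTo n m := by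
  induction m with
  | zero => rfl
  | succ m ih => rw [upTo, upTo, ih fun j hj => h j (by omega), h m (by omega)]

/-- The factors above level `m` are the same for all paths which agree there. -/
lemma exists_up_eq (n : ℕ) (t : KroneckerTableau r ν) {m : ℕ} (hm : m ≤ r) :
    ∃ A : PartitionAlgebra r n, ∀ t' : KroneckerTableau r ν,
      (∀ j, m ≤ j → t'.factor n j = t.factor n j) → t'.up n = A * t'.upTo n m := by
  suffices ∀ m', m ≤ m' → ∃ A : PartitionAlgebra r n, ∀ t' : KroneckerTableau r ν,
      (∀ j, m ≤ j → t'.factor n j = t.factor n j) → t'.upTo n m' = A * t'.upTo n m by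
    simp only [up_eq_upTo]
    exact this r hm
  intro m' hm'
  induction m', hm' using Nat.le_induction with
  | base => exact ⟨1, fun t' _ => (one_mul _).symm⟩
  | succ m' hm' ih =>
    obtain ⟨A, hA⟩ := ih
    refine ⟨t.factor n m' * A, fun t' ht' => ?_⟩
    rw [upTo, hA t' ht', ht' m' hm', mul_assoc]

lemma isRowInvariant_upTo (t : KroneckerTableau r ν) {m : ℕ} (hm : m ≤ r) :
    IsRowInvariant m (t.shape ⟨m, by omega⟩) (t.upTo n m) := by
  induction m with
  | zero =>
    have h0 : ∀ i, (t.shape ⟨0, by omega⟩).rowLen i = 0 := by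
      intro i
      have : t.shape ⟨0, by omega⟩ = ⊥ := t.shape_zero
      rw [this]
      exact rowLen_eq_zero_of_card_le (by simp [YoungDiagram.card])
    constructor
    · refine Submodule.subset_span ⟨fun _ => [], fun j => j, ⟨?_, ?_, ?_, ?_⟩, ?_⟩
      · exact fun i => (h0 i).symm
      · intro i c hc
        cases hc
      · exact fun j hj => hj
      · exact fun j _ => rfl
      · have hw : rowWord r (fun _ => []) = [] := by simp [rowWord]
        rw [upTo, hw, ← coloured_self_eq_one]
        apply coloured_congr
        · intro j hj _
          rw [wordTop_of_lt (by rw [List.length_nil]; omega), if_neg (by omega)]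
        · exact fun _ _ _ => rfl
    · intro q j hj
      rw [h0] at hj
      omega
  | succ m ih =>
    rw [upTo, factor, dif_pos (by omega)]
    exact (ih (by omega)).step (t.step_sub ⟨m, by omega⟩) (t.step_add ⟨m, by omega⟩) (by omega)
      (t.card_shape_le _)

lemma IsSwap.factor_eq {t t' : KroneckerTableau r ν} {k : ℕ} {h1 : 1 ≤ k} {hr : k < r}
    (h : t.IsSwap k h1 hr t') {j : ℕ} (hj : j ≠ k - 1) (hj' : j ≠ k) :
    t'.factor n j = t.factor n j := by
  rw [factor, factor]
  split_ifs with hjr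
  · have e1 := h.shape_eq ⟨j, by omega⟩ hj'
    have e2 := h.shape_eq ⟨j + 1, by omega⟩ (by simp only; omega)
    have e3 := h.half_eq ⟨j, hjr⟩ hj hj'
    have s1 := t.step_sub ⟨j, hjr⟩
    have s2 := t.step_add ⟨j, hjr⟩
    have s1' := t'.step_sub ⟨j, hjr⟩
    have s2' := t'.step_add ⟨j, hjr⟩
    simp only [Fin.castSucc_mk, Fin.succ_mk] at s1 s2 s1' s2'
    rw [e1, e3] at s1'
    rw [e2, e3] at s2'
    rw [e1, e2, e3, s1'.label_unique s1, s2'.label_unique s2]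
  · rfl

lemma errorPath_factor_eq (t : KroneckerTableau r ν) {k : ℕ} {h1 : 1 ≤ k} {hr : k < r}
    (h : t.HasError k h1 hr) {j : ℕ} (hj : j ≠ k - 1) (hj' : j ≠ k) :
    (t.errorPath k h1 hr h).factor n j = t.factor n j := by
  rw [factor, factor]
  split_ifs with hjr
  · simp only [errorPath]
    rw [Function.update_of_ne, Function.update_of_ne, Function.update_of_ne,
      Function.update_of_ne]
    all_goals
      rw [Ne, Fin.ext_iff]
      simp only
      omega
  · rfl

lemma errorPath_factor_mul (t : KroneckerTableau r ν) {k : ℕ} {h1 : 1 ≤ k + 1} {hr : k + 1 < r}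
    (h : t.HasError (k + 1) h1 hr) :
    (t.errorPath (k + 1) h1 hr h).factor n (k + 1) * (t.errorPath (k + 1) h1 hr h).factor n k =
      errorElt r n k (t.shape ⟨k, by omega⟩) (t.half ⟨k, by omega⟩) (t.half ⟨k + 1, hr⟩)
        (t.shape ⟨k + 2, by omega⟩) (t.sub ⟨k, by omega⟩) (t.add ⟨k + 1, hr⟩) := by
  rw [factor, factor, dif_pos hr, dif_pos (by omega), errorElt]
  simp only [errorPath, Nat.add_sub_cancel, Function.update_self]
  congr 2 <;> rw [Function.update_of_ne] <;> rw [Ne, Fin.ext_iff] <;> simp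

lemma upError_eq {t : KroneckerTableau r ν} {k : ℕ} {h1 : 1 ≤ k + 1} {hr : k + 1 < r}
    {A X : PartitionAlgebra r n}
    (hA : ∀ s : KroneckerTableau r ν, (∀ j, k + 2 ≤ j → s.factor n j = t.factor n j) →
      s.up n = A * s.upTo n (k + 2)) (hX : t.upTo n k = X) :
    t.upError n (k + 1) h1 hr =
      A * if t.add ⟨k, by omega⟩ = t.sub ⟨k + 1, hr⟩ ∧ 0 < t.sub ⟨k + 1, hr⟩ then
        errorElt r n k (t.shape ⟨k, by omega⟩) (t.half ⟨k, by omega⟩) (t.half ⟨k + 1, hr⟩)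
          (t.shape ⟨k + 2, by omega⟩) (t.sub ⟨k, by omega⟩) (t.add ⟨k + 1, hr⟩) * X
      else 0 := by
  rw [upError]
  by_cases h : t.HasError (k + 1) h1 hr
  · have h' : t.add ⟨k, by omega⟩ = t.sub ⟨k + 1, hr⟩ ∧ 0 < t.sub ⟨k + 1, hr⟩ := h
    rw [dif_pos h, if_pos h', hA, upTo, upTo, upTo_congr, hX, ← errorPath_factor_mul t h, mul_assoc]
    · intro j hj
      exact errorPath_factor_eq t h (by omega) (by omega)
    · intro j hj
      exact errorPath_factor_eq t h (by omega) (by omega)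
  · have h' : ¬ (t.add ⟨k, by omega⟩ = t.sub ⟨k + 1, hr⟩ ∧ 0 < t.sub ⟨k + 1, hr⟩) := h
    rw [dif_neg h, if_neg h', mul_zero]

end KroneckerTableau

end

end PartitionAlg

theorem mainTheorem3 (r n : ℕ) (ν : YoungDiagram)
    (t t' : PartitionAlg.KroneckerTableau r ν) (k : ℕ) (h1 : 1 ≤ k) (hr : k < r)
    (hswap : t.IsSwap k h1 hr t') :
    t.up n * PartitionAlg.sGen r n k =
      t'.up n + t.upError n k h1 hr - t'.upError n k h1 hr := by
  obtain ⟨k, rfl⟩ : ∃ k', k = k' + 1 := ⟨k - 1, by omega⟩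
  obtain ⟨A, hA⟩ := t.exists_up_eq n (m := k + 2) (by omega)
  have hfac : ∀ j, j < k ∨ k + 2 ≤ j → t'.factor n j = t.factor n j := fun j hj =>
    hswap.factor_eq (by omega) (by omega)
  have hX : t'.upTo n k = t.upTo n k :=
    PartitionAlg.KroneckerTableau.upTo_congr fun j hj => hfac j (Or.inl hj)
  have hA' : ∀ s : PartitionAlg.KroneckerTableau r ν,
      (∀ j, k + 2 ≤ j → s.factor n j = t'.factor n j) → s.up n = A * s.upTo n (k + 2) :=
    fun s hs => hA s fun j hj => (hs j hj).trans (hfac j (Or.inr hj))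
  have hlam := hswap.shape_eq ⟨k, by omega⟩ (by simp)
  have hρ' := hswap.shape_eq ⟨k + 2, by omega⟩ (by simp)
  have hv : t'.sub ⟨k, by omega⟩ = _ := hswap.sub_fst
  have hw : t'.add ⟨k, by omega⟩ = _ := hswap.add_fst
  have ht : _ = t.sub ⟨k, by omega⟩ := hswap.sub_snd
  have hu : _ = t.add ⟨k, by omega⟩ := hswap.add_snd
  have s1 := t.step_sub ⟨k, by omega⟩
  have s2 := t.step_add ⟨k, by omega⟩
  have s3 := t.step_sub ⟨k + 1, hr⟩
  have s4 := t.step_add ⟨k + 1, hr⟩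
  have s1' := t'.step_sub ⟨k, by omega⟩
  have s2' := t'.step_add ⟨k, by omega⟩
  have s3' := t'.step_sub ⟨k + 1, hr⟩
  have s4' := t'.step_add ⟨k + 1, hr⟩
  simp only [Fin.castSucc_mk, Fin.succ_mk] at s1 s2 s3 s4 s1' s2' s3' s4'
  rw [hv, hlam] at s1'
  rw [hw] at s2'
  rw [ht] at s3'
  rw [hu, hρ'] at s4'
  have key := PartitionAlg.two_steps_mul_sGen (n := n) (t.isRowInvariant_upTo (by omega)) hr
    (t.card_shape_le ⟨k, by omega⟩) s1 s2 s3 s4 s1' s2' s3' s4'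
  rw [PartitionAlg.KroneckerTableau.upError_eq hA rfl,
    PartitionAlg.KroneckerTableau.upError_eq hA' hX, hA t fun _ _ => rfl,
    hA' t' fun _ _ => rfl, mul_assoc, ← mul_add, ← mul_sub]
  congr 1
  simp only [PartitionAlg.KroneckerTableau.upTo, PartitionAlg.KroneckerTableau.factor]
  rw [dif_pos hr, dif_pos (by omega), dif_pos hr, dif_pos (by omega), hX, hv, hw, ht, hu, hlam,
    hρ']
  exact key
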